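/- Notation. Let $k\in\mathbb N$, $k\ge 1$. Let $\mu$ be the uniform probability measure on $[-1,1]^k$, let $L_n$ be the $n$th Legendre polynomial normalized in $L^2([-1,1];\frac{dx}{2})$, and let $L_\nu(y)=\prod_{j=1}^k L_{\nu_j}(y_j)$ for $\nu\in\mathbb N_0^k$. For $\rho>1$ let $\mathcal E_\rho=\{\frac{z+z^{-1}}{2} : z\in\mathbb C,\ 1\le |z|\le\rho\}$ be the Bernstein ellipse, and for $\xi\in(1,\infty)^k$ let $\mathcal E_\xi=\mathcal E_{\xi_1}\times\cdots\times\mathcal E_{\xi_k}$ and $\xi_{\min}=\min_j\xi_j$. Let $B_s=\{z\in\mathbb C:|z|<s\}$. By $f\in C^1(\mathcal E_\xi;B_r)$ we mean that $f:\mathcal E_\xi\to B_r$ is continuous, and complex differentiable in the interior of $\mathcal E_\xi$. Put $$\|u\|_{W^{m,\infty}([-1,1]^k)}=\max_{|\alpha|\le m}\|\partial^\alpha u\|_{L^\infty([-1,1]^k)},\qquad \gamma(\xi,\nu)=\xi_k^{-\max\{1,\nu_k\}}\prod_{j=1}^{k-1}\xi_j^{-\nu_j},$$ $$\Lambda_{k,\varepsilon}=\{\nu\in\mathbb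 N_0^k:\gamma(\xi,\nu)\ge\varepsilon\},\qquad \beta=\Big(k!\prod_{j=1}^k\log\xi_j\Big)^{1/k}.$$ Proposition. Let $k\ge 1$, $m\in\mathbb N_0$ and $\tau\in(0,1)$. There is a constant $C>0$, depending only on $k$, $m$, $\tau$ and $\xi_{\min}$, such that the following holds for all $\xi\in(1,\infty)^k$ with the given value of $\xi_{\min}$, all $r>0$ and all $f\in C^1(\mathcal E_\xi;B_r)$ with $f(\mathcal E_{\xi_1}\times\cdots\times\mathcal E_{\xi_{k-1}}\times[-1,1])\subseteq B_{r/\xi_k}$. Let $l_\nu=\int_{[-1,1]^k}f(y)L_\nu(y)\,\mu(dy)$ for $\nu\in\mathbb N_0^k$, and let $$M=\min\{r,\ \xi_k\|f\|_{L^\infty(\mathcal E_\xi)}\}.$$ Then for every $\varepsilon\in(0,\xi_k^{-1})$ the set $\Lambda_{k,\varepsilon}$ is finite, $f-\sum_{\nu\in\Lambda_{k,\varepsilon}}l_\nu L_\nu$ is $m$ times continuously differentiable on $(-1,1)^k$, and $$\Big\|f-\sum_{\nu\in\Lambda_{k,\varepsilon}}l_\nu L_\nu\Big\|_{W^{m,\infty}([-1,1]^k)}\le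 C\,M\,\varepsilon^\tau\le C\,M\exp\!\big(-\tau\beta|\Lambda_{k,\varepsilon}|^{1/k}\big)\prod_{j=1}^k\xi_j .$$ In particular, the error is at most $C_1\varepsilon^\tau\le C_1\exp(-\tau\beta|\Lambda_{k,\varepsilon}|^{1/k})\prod_{j=1}^k\xi_j$ with $C_1=Cr$ depending only on $k,m,\tau,\xi_{\min},r$. It is also at most $C_2\varepsilon^\tau\|f\|_{L^\infty(\mathcal E_\xi)}\le C_2\exp(-\tau\beta|\Lambda_{k,\varepsilon}|^{1/k})\|f\|_{L^\infty(\mathcal E_\xi)}\prod_{j=1}^k\xi_j$ with $C_2=C\xi_k$ depending only on $k,m,\tau,\xi_{\min},\xi_k$. -/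

import Mathlib

open MeasureTheory Set Polynomial
open scoped ENNReal Nat ContDiff

noncomputable section

namespace LegendreApprox

/-- The (filled, closed) Bernstein ellipse
`{(z + z⁻¹) / 2 : z ∈ ℂ, 1 ≤ |z| ≤ ρ}`. -/
def bernsteinEllipse (ρ : ℝ) : Set ℂ :=
  (fun z : ℂ => (z + z⁻¹) / 2) '' {z : ℂ | 1 ≤ ‖z‖ ∧ ‖z‖ ≤ ρ}

/-- The Bernstein polyellipse, the product of the ellipses with parameters `ξ j`. -/
def polyellipse {n : ℕ} (ξ : Fin n → ℝ) : Set (Fin n → ℂ) :=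
  {z | ∀ j, z j ∈ bernsteinEllipse (ξ j)}

/-- The product of the ellipses in all variables but the last one with the real interval `[-1,1]`
in the last variable. -/
def polyellipseRealLast {d : ℕ} (ξ : Fin (d + 1) → ℝ) : Set (Fin (d + 1) → ℂ) :=
  {z | (∀ j : Fin d, z j.castSucc ∈ bernsteinEllipse (ξ j.castSucc)) ∧
    ∃ t : ℝ, t ∈ Icc (-1 : ℝ) 1 ∧ z (Fin.last d) = (t : ℂ)}

/-- `f ∈ C¹(O; ℂ)` in the complex sense, for a set `O ⊆ ℂⁿ` that need not be open: `f` is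
continuous on `O` and complex differentiable on the interior of `O` (that is, on every open
subset of `O`). -/
def HolomorphicC1On {n : ℕ} (f : (Fin n → ℂ) → ℂ) (O : Set (Fin n → ℂ)) : Prop :=
  ContinuousOn f O ∧ DifferentiableOn ℂ f (interior O)

/-- The supremum norm of `f` on the set `O`. -/
def supNormOn {n : ℕ} (f : (Fin n → ℂ) → ℂ) (O : Set (Fin n → ℂ)) : ℝ :=
  ⨆ z : O, ‖f z‖

/-- The uniform probability measure on `[-1,1]`, i.e. half the Lebesgue measure. -/
def mu1 : Measure ℝ := (2 : ℝ≥0∞)⁻¹ • (volume : Measure ℝ).restrict (Icc (-1) 1)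

/-- The uniform probability measure on `[-1,1]ⁿ`. -/
def mu (n : ℕ) : Measure (Fin n → ℝ) := Measure.pi fun _ => mu1

/-- The `n`-th Legendre polynomial, normalized in `L²([-1,1]; mu1)`: `√(2n+1)` times the
classical Legendre polynomial, which is given by Rodrigues' formula. -/
def legendre (n : ℕ) : ℝ[X] :=
  C (Real.sqrt (2 * n + 1) / (2 ^ n * (n ! : ℝ))) * derivative^[n] ((X ^ 2 - 1) ^ n)

/-- The tensorized Legendre polynomial `L_ν(y) = ∏ j, L_{ν j}(y j)`. -/
def legendreTensor {n : ℕ} (ν : Fin n → ℕ) (y : Fin n → ℝ) : ℝ :=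
  ∏ j, (legendre (ν j)).eval (y j)

/-- The point of `ℂⁿ` given by a point of `ℝⁿ`. -/
def toComplex {n : ℕ} (y : Fin n → ℝ) : Fin n → ℂ := fun j => (y j : ℂ)

/-- The Legendre coefficient `∫_{[-1,1]ⁿ} f L_ν dμ`. -/
def legendreCoeff {n : ℕ} (f : (Fin n → ℂ) → ℂ) (ν : Fin n → ℕ) : ℂ :=
  ∫ y, f (toComplex y) * (legendreTensor ν y : ℂ) ∂(mu n)

/-- `γ(ξ,ν) = ξ_k ^ (-max {1, ν_k}) * ∏_{j<k} ξ_j ^ (-ν_j)`, where `k = d + 1`. -/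
def gamma {d : ℕ} (ξ : Fin (d + 1) → ℝ) (ν : Fin (d + 1) → ℕ) : ℝ :=
  (ξ (Fin.last d) ^ max 1 (ν (Fin.last d)))⁻¹ *
    ∏ j : Fin d, (ξ j.castSucc ^ ν j.castSucc)⁻¹

/-- The index set `Λ_{k,ε} = {ν : γ(ξ,ν) ≥ ε}`. -/
def indexSet {d : ℕ} (ξ : Fin (d + 1) → ℝ) (ε : ℝ) : Set (Fin (d + 1) → ℕ) :=
  {ν | ε ≤ gamma ξ ν}

/-- The difference of `f` and its Legendre expansion truncated to `Λ`, on `ℝⁿ`. -/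
def truncationError {n : ℕ} (f : (Fin n → ℂ) → ℂ) (Λ : Set (Fin n → ℕ)) (y : Fin n → ℝ) : ℂ :=
  f (toComplex y) - ∑ᶠ (ν : Fin n → ℕ) (_ : ν ∈ Λ), legendreCoeff f ν * (legendreTensor ν y : ℂ)

/-- The open cube `(-1,1)ⁿ`, the interior of `[-1,1]ⁿ`. -/
def openCube (n : ℕ) : Set (Fin n → ℝ) := Set.univ.pi fun _ => Ioo (-1) 1

/-- The partial derivative `∂u/∂x_j`. -/
def partialDeriv {n : ℕ} (j : Fin n) (u : (Fin n → ℝ) → ℂ) : (Fin n → ℝ) → ℂ :=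
  fun x => lineDeriv ℝ u x (Pi.single j 1)

/-- The mixed partial derivative `∂^|α| u / (∂x_1^{α_1} ⋯ ∂x_n^{α_n})`. -/
def multiDeriv {n : ℕ} (α : Fin n → ℕ) (u : (Fin n → ℝ) → ℂ) : (Fin n → ℝ) → ℂ :=
  (List.finRange n).foldr (fun j v => (partialDeriv j)^[α j] v) u

/-- The norm `max_{|α| ≤ m} ‖∂^α u‖_{L^∞}` of `W^{m,∞}([-1,1]ⁿ)`, for functions `u` that are `m`
times continuously differentiable on the open cube (the boundary is a null set). -/
def sobolevNorm {n : ℕ} (m : ℕ) (u : (Fin n → ℝ) → ℂ) : ℝ≥0∞ :=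
  ⨆ (α : Fin n → ℕ) (_ : ∑ j, α j ≤ m), eLpNorm (multiDeriv α u) ∞ (volume.restrict (openCube n))

/-- `β = (k! ∏ log ξ_j)^{1/k}`. -/
def beta {k : ℕ} (ξ : Fin k → ℝ) : ℝ :=
  ((k ! : ℝ) * ∏ j, Real.log (ξ j)) ^ (1 / (k : ℝ))

end LegendreApprox

end

/-!
Composing `f` with the Joukowski map `z ↦ (z + z⁻¹) / 2` in each variable turns the Chebyshev
expansion of `f` into a Laurent expansion on a polyannulus, symmetric under `z j ↦ (z j)⁻¹`.
Shifting the contours towards the boundary of the annulus bounds the coefficient with index `n`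
by `M * gamma ξ |n|`; in a last variable with `n = 0` the contour stays on the unit circle, where
the smaller bound `M / ξ (Fin.last d)` on `f` produces the exponent `max 1 |n|`.

The polynomial `∏ j, T_{n j}` is a combination of the `L_ν` with `ν ≤ |n|`. As `Λ = indexSet ξ ε`
is a lower set, the terms with `|n| ∈ Λ` are reproduced exactly by the truncation, and in the
remaining ones `gamma = gamma ^ τ * gamma ^ (1 - τ) ≤ ε ^ τ * gamma ^ (1 - τ)`, where the second
factor still decays geometrically. Derivatives of order `m` and the passage from Chebyshev to
Legendre polynomials cost only polynomial factors in `n`, which this decay absorbs.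

Comparing the number of lattice points of `Λ` with the volume of a simplex yields the
exponential form of the bound.
-/

namespace LegendreApprox

section PolynomialInequalities

theorem iterate_derivative_comp_C_mul_X_add_C {R : Type*} [CommSemiring R] (p : R[X]) (a b : R)
    (k : ℕ) : derivative^[k] (p.comp (C a * X + C b))
      = C (a ^ k) * (derivative^[k] p).comp (C a * X + C b) := by
  induction k with
  | zero => simp
  | succ k ih =>
    rw [Function.iterate_succ_apply', ih, derivative_C_mul, derivative_comp,
      ← Function.iterate_succ_apply' derivative]
    simp only [derivative_add, derivative_C_mul, derivative_X, derivative_C, C_pow]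
    ring

theorem eval_one_iterate_derivative_T_le (n k : ℕ) :
    (derivative^[k] (Chebyshev.T ℝ n)).eval 1 ≤ ((n : ℝ) ^ 2) ^ k := by
  have nonneg (i : ℕ) : 0 ≤ (derivative^[i] (Chebyshev.T ℝ n)).eval 1 :=
    (abs_nonneg _).trans (Chebyshev.abs_iterate_derivative_T_real_le n i (x := 1) (by simp))
  induction k with
  | zero => simp
  | succ k ih =>
    have recurrence := Chebyshev.iterate_derivative_T_eval_one_recurrence (R := ℝ) n k
    push_cast at recurrence
    calc (derivative^[k + 1] (Chebyshev.T ℝ n)).eval 1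
        ≤ (n : ℝ) ^ 2 * (derivative^[k] (Chebyshev.T ℝ n)).eval 1 := by
          nlinarith [mul_nonneg (Nat.cast_nonneg (α := ℝ) k) (nonneg (k + 1)),
            mul_nonneg (sq_nonneg (k : ℝ)) (nonneg k)]
      _ ≤ (n : ℝ) ^ 2 * ((n : ℝ) ^ 2) ^ k := by gcongr
      _ = ((n : ℝ) ^ 2) ^ (k + 1) := (pow_succ' _ _).symm

theorem abs_eval_one_iterate_derivative_le {n : ℕ} {p : ℝ[X]} (hdeg : p.natDegree ≤ n)
    (hp : ∀ x ∈ Icc (-1 : ℝ) 1, |p.eval x| ≤ 1) (k : ℕ) :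
    |(derivative^[k] p).eval 1| ≤ ((n : ℝ) ^ 2) ^ k := by
  have upper {q : ℝ[X]} (hdeg : q.natDegree ≤ n) (hq : ∀ x ∈ Icc (-1 : ℝ) 1, |q.eval x| ≤ 1) :
      (derivative^[k] q).eval 1 ≤ ((n : ℝ) ^ 2) ^ k :=
    (Chebyshev.eval_iterate_derivative_le_of_forall_abs_le_one le_rfl
      (natDegree_le_iff_degree_le.1 hdeg) hq).trans (eval_one_iterate_derivative_T_le n k)
  refine abs_le'.2 ⟨upper hdeg hp, ?_⟩
  rw [← eval_neg, ← iterate_derivative_neg]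
  exact upper ((natDegree_neg p).trans_le hdeg) (by simpa using hp)

/- An affine map sends `1` to `x` and `-1` to the endpoint of `[-1,1]` farther from `x`; its slope
is at least `1/2` in absolute value, which reduces the claim to the endpoint `1`. -/
theorem abs_eval_iterate_derivative_le {n : ℕ} {p : ℝ[X]} (hdeg : p.natDegree ≤ n)
    (hp : ∀ x ∈ Icc (-1 : ℝ) 1, |p.eval x| ≤ 1) (k : ℕ) {x : ℝ} (hx : x ∈ Icc (-1 : ℝ) 1) :
    |(derivative^[k] p).eval x| ≤ (2 * (n : ℝ) ^ 2) ^ k := by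
  obtain ⟨s, hs, hslope⟩ : ∃ s ∈ Icc (-1 : ℝ) 1, 1 ≤ |x - s| := by
    rcases le_total 0 x with h | h
    · exact ⟨-1, by norm_num, le_abs.2 (.inl (by linarith))⟩
    · exact ⟨1, by norm_num, le_abs.2 (.inr (by linarith))⟩
  set q := p.comp (C ((x - s) / 2) * X + C ((x + s) / 2)) with hq
  have q_deg : q.natDegree ≤ n :=
    natDegree_comp_le.trans
      ((Nat.mul_le_mul hdeg natDegree_linear_le).trans_eq (mul_one n))
  have q_bound (t : ℝ) (ht : t ∈ Icc (-1 : ℝ) 1) : |q.eval t| ≤ 1 := by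
    rw [hq, eval_comp]
    simp only [eval_add, eval_mul, eval_C, eval_X]
    apply hp
    constructor <;> nlinarith [hx.1, hx.2, hs.1, hs.2, ht.1, ht.2]
  have eval_q : (derivative^[k] q).eval 1 = ((x - s) / 2) ^ k * (derivative^[k] p).eval x := by
    rw [hq, iterate_derivative_comp_C_mul_X_add_C, eval_mul, eval_C, eval_comp]
    simp only [eval_add, eval_mul, eval_C, eval_X]
    ring_nf
  calc |(derivative^[k] p).eval x|
      ≤ 2 ^ k * (|(x - s) / 2| ^ k * |(derivative^[k] p).eval x|) := by
        rw [← mul_assoc, ← mul_pow, abs_div, abs_two, mul_div_cancel₀ _ two_ne_zero]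
        exact le_mul_of_one_le_left (abs_nonneg _) (one_le_pow₀ hslope)
    _ = 2 ^ k * |(derivative^[k] q).eval 1| := by rw [eval_q, abs_mul, abs_pow]
    _ ≤ 2 ^ k * ((n : ℝ) ^ 2) ^ k := by
        gcongr
        exact abs_eval_one_iterate_derivative_le q_deg q_bound k
    _ = (2 * (n : ℝ) ^ 2) ^ k := (mul_pow _ _ _).symm

theorem exists_derivative_eq {n : ℕ} {q : ℝ[X]} (hq : q.natDegree ≤ n) :
    ∃ p : ℝ[X], derivative p = q ∧ p.natDegree ≤ n + 1 := by
  refine ⟨∑ i ∈ Finset.range (n + 1), monomial (i + 1) (q.coeff i / (i + 1)), ?_,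
    natDegree_sum_le_of_forall_le _ _ fun i hi => (natDegree_monomial_le _).trans ?_⟩
  · conv_rhs => rw [q.as_sum_range' (n + 1) (Nat.lt_succ_of_le hq)]
    rw [derivative_sum]
    refine Finset.sum_congr rfl fun i _ => ?_
    rw [derivative_monomial]
    congr 1
    push_cast
    field_simp
  · exact Nat.succ_le_succ (Finset.mem_range_succ_iff.1 hi)

theorem abs_eval_iterate_derivative_le_of_integral_abs_le {n : ℕ} {q : ℝ[X]}
    (hdeg : q.natDegree ≤ n) (hq : ∫ x in (-1 : ℝ)..1, |q.eval x| ≤ 1) (k : ℕ) {x : ℝ}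
    (hx : x ∈ Icc (-1 : ℝ) 1) :
    |(derivative^[k] q).eval x| ≤ (2 * ((n : ℝ) + 1) ^ 2) ^ (k + 1) := by
  obtain ⟨p, rfl, hp⟩ := exists_derivative_eq hdeg
  set P := p - C (p.eval (-1))
  have P_deriv : derivative P = derivative p := by simp [P]
  have P_bound (y : ℝ) (hy : y ∈ Icc (-1 : ℝ) 1) : |P.eval y| ≤ 1 := by
    have ftc : ∫ t in (-1 : ℝ)..y, (derivative p).eval t = P.eval y := by
      rw [intervalIntegral.integral_eq_sub_of_hasDerivAt (fun t _ => p.hasDerivAt t)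
        ((derivative p).continuous.intervalIntegrable _ _)]
      simp [P]
    rw [← ftc]
    calc |∫ t in (-1 : ℝ)..y, (derivative p).eval t|
        ≤ ∫ t in (-1 : ℝ)..y, |(derivative p).eval t| :=
          intervalIntegral.abs_integral_le_integral_abs hy.1
      _ ≤ ∫ t in (-1 : ℝ)..1, |(derivative p).eval t| :=
          intervalIntegral.integral_mono_interval le_rfl hy.1 hy.2
            (ae_of_all _ fun t => abs_nonneg _) (Continuous.intervalIntegrable (by fun_prop) _ _)
      _ ≤ 1 := hq
  have P_deg : P.natDegree ≤ n + 1 := (natDegree_sub_C (a := p.eval (-1))).trans_le hp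
  rw [← P_deriv, ← Function.iterate_succ_apply]
  exact_mod_cast abs_eval_iterate_derivative_le P_deg P_bound (k + 1) hx

end PolynomialInequalities

section UniformMeasure

theorem integral_mu1 {E : Type*} [NormedAddCommGroup E] [NormedSpace ℝ E] (g : ℝ → E) :
    ∫ x, g x ∂mu1 = (2⁻¹ : ℝ) • ∫ x in (-1 : ℝ)..1, g x := by
  rw [mu1, integral_smul_measure, intervalIntegral.integral_of_le (by norm_num),
    integral_Icc_eq_integral_Ioc, ENNReal.toReal_inv, ENNReal.toReal_ofNat]

instance isProbabilityMeasure_mu1 : IsProbabilityMeasure mu1 := by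
  constructor
  rw [mu1, Measure.smul_apply, Measure.restrict_apply_univ, Real.volume_Icc, smul_eq_mul,
    show (1 - (-1) : ℝ) = 2 by norm_num, ENNReal.ofReal_ofNat]
  exact ENNReal.inv_mul_cancel (by norm_num) (by norm_num)

theorem ae_mem_Icc_mu1 : ∀ᵐ x ∂mu1, x ∈ Icc (-1 : ℝ) 1 :=
  Measure.ae_smul_measure (ae_restrict_mem measurableSet_Icc) _

theorem integrable_mu1_of_continuous {E : Type*} [NormedAddCommGroup E] {g : ℝ → E}
    (hg : Continuous g) : Integrable g mu1 :=
  (hg.continuousOn.integrableOn_compact isCompact_Icc).smul_measure (by simp)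

instance isProbabilityMeasure_mu (n : ℕ) : IsProbabilityMeasure (mu n) := by
  unfold mu
  infer_instance

theorem ae_mem_Icc_mu (n : ℕ) : ∀ᵐ y ∂mu n, ∀ j, y j ∈ Icc (-1 : ℝ) 1 :=
  ae_all_iff.2 fun j =>
    (Measure.tendsto_eval_ae_ae (μ := fun _ => mu1) (i := j)).eventually ae_mem_Icc_mu1

end UniformMeasure

section LegendrePolynomials

theorem integral_derivative_mul {p q : ℝ[X]} (hp : p.eval 1 = 0) (hp' : p.eval (-1) = 0) :
    ∫ x in (-1 : ℝ)..1, (derivative p * q).eval x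
      = -∫ x in (-1 : ℝ)..1, (p * derivative q).eval x := by
  have := intervalIntegral.integral_mul_deriv_eq_deriv_mul (a := -1) (b := 1)
    (u := fun x => q.eval x) (v := fun x => p.eval x)
    (fun x _ => q.hasDerivAt x) (fun x _ => p.hasDerivAt x)
    ((derivative q).continuous.intervalIntegrable _ _)
    ((derivative p).continuous.intervalIntegrable _ _)
  simp only [hp, hp', mul_zero, sub_zero, zero_sub] at this
  simpa only [eval_mul, mul_comm] using this

theorem eval_iterate_derivative_pow_eq_zero {R : Type*} [CommRing R] {p : R[X]} {x : R}
    (hp : p.eval x = 0) {n i : ℕ} (hi : i < n) : (derivative^[i] (p ^ n)).eval x = 0 := by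
  obtain ⟨q, hq⟩ := pow_sub_dvd_iterate_derivative_pow p n i
  rw [hq, eval_mul, eval_pow, hp, zero_pow (Nat.sub_ne_zero_of_lt hi), zero_mul]

theorem integral_iterate_derivative_sq_sub_one_pow_mul {n i : ℕ} (hi : i ≤ n) (q : ℝ[X]) :
    ∫ x in (-1 : ℝ)..1, (derivative^[i] ((X ^ 2 - 1) ^ n) * q).eval x
      = (-1) ^ i * ∫ x in (-1 : ℝ)..1, ((X ^ 2 - 1) ^ n * derivative^[i] q).eval x := by
  induction i generalizing q with
  | zero => simp
  | succ i ih =>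
    rw [Function.iterate_succ_apply',
      integral_derivative_mul (eval_iterate_derivative_pow_eq_zero (by simp) hi)
        (eval_iterate_derivative_pow_eq_zero (by simp) hi),
      ih (Nat.le_of_succ_le hi), ← Function.iterate_succ_apply]
    ring

theorem factorial_mul_integral_one_sub_sq_pow (n : ℕ) :
    ((2 * n + 1)! : ℝ) * ∫ x in (-1 : ℝ)..1, (1 - x ^ 2) ^ n = 2 * 4 ^ n * (n ! : ℝ) ^ 2 := by
  have wallis : ∫ x in (-1 : ℝ)..1, (1 - x ^ 2) ^ n
      = 2 * ∏ i ∈ Finset.range n, (2 * (i : ℝ) + 2) / (2 * i + 3) := by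
    rw [← integral_sin_pow_odd]
    simpa using (integral_sin_pow_odd_mul_cos_pow (a := 0) (b := Real.pi) n 0).symm
  rw [wallis]
  clear wallis
  induction n with
  | zero => simp
  | succ n ih =>
    rw [Finset.prod_range_succ, show 2 * (n + 1) + 1 = (2 * n + 1 + 1) + 1 by ring,
      Nat.factorial_succ (2 * n + 1 + 1), Nat.factorial_succ (2 * n + 1), Nat.factorial_succ n]
    generalize ∏ i ∈ Finset.range n, (2 * (i : ℝ) + 2) / (2 * i + 3) = P at ih ⊢
    have : (2 * (n : ℝ) + 3) * ((2 * n + 2) / (2 * n + 3)) = 2 * n + 2 := by field_simp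
    push_cast
    linear_combination (2 * (n : ℝ) + 2) ^ 2 * ih + 2 * (2 * n + 2) * ((2 * n + 1)! : ℝ) * P * this

theorem monic_X_sq_sub_one_pow (n : ℕ) : ((X ^ 2 - 1 : ℝ[X]) ^ n).Monic :=
  (monic_X_pow_sub_C (1 : ℝ) two_ne_zero).pow n

theorem natDegree_X_sq_sub_one_pow (n : ℕ) : ((X ^ 2 - 1 : ℝ[X]) ^ n).natDegree = 2 * n := by
  rw [natDegree_pow, ← C_1, natDegree_X_pow_sub_C, mul_comm]

theorem coeff_X_sq_sub_one_pow (n : ℕ) : ((X ^ 2 - 1 : ℝ[X]) ^ n).coeff (2 * n) = 1 := by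
  rw [← natDegree_X_sq_sub_one_pow]
  exact monic_X_sq_sub_one_pow n

theorem degree_legendre (n : ℕ) : (legendre n).degree = n := by
  have hc : Real.sqrt (2 * n + 1) / (2 ^ n * (n ! : ℝ)) ≠ 0 := by positivity
  rw [legendre, degree_C_mul hc]
  apply le_antisymm
  · refine natDegree_le_iff_degree_le.1 ((natDegree_iterate_derivative _ _).trans ?_)
    rw [natDegree_X_sq_sub_one_pow]
    omega
  · refine le_degree_of_ne_zero ?_
    rw [coeff_iterate_derivative, ← two_mul, coeff_X_sq_sub_one_pow, nsmul_one,
      Nat.cast_ne_zero, Ne, Nat.descFactorial_eq_zero_iff_lt]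
    omega

theorem natDegree_legendre (n : ℕ) : (legendre n).natDegree = n :=
  natDegree_eq_of_degree_eq_some (degree_legendre n)

theorem iterate_derivative_X_sq_sub_one_pow (n : ℕ) :
    derivative^[2 * n] ((X ^ 2 - 1 : ℝ[X]) ^ n) = C ((2 * n)! : ℝ) := by
  have hdeg : (derivative^[2 * n] ((X ^ 2 - 1 : ℝ[X]) ^ n)).natDegree = 0 := by
    have := natDegree_iterate_derivative ((X ^ 2 - 1 : ℝ[X]) ^ n) (2 * n)
    rwa [natDegree_X_sq_sub_one_pow, Nat.sub_self, Nat.le_zero] at this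
  rw [eq_C_of_natDegree_eq_zero hdeg, coeff_iterate_derivative, zero_add, coeff_X_sq_sub_one_pow,
    Nat.descFactorial_self, nsmul_one]

theorem integral_rodrigues_mul_self (n : ℕ) :
    ((2 * n + 1 : ℕ) : ℝ) * ∫ x in (-1 : ℝ)..1,
        (derivative^[n] ((X ^ 2 - 1 : ℝ[X]) ^ n) * derivative^[n] ((X ^ 2 - 1) ^ n)).eval x
      = 2 * (2 ^ n * (n ! : ℝ)) ^ 2 := by
  rw [integral_iterate_derivative_sq_sub_one_pow_mul le_rfl, ← Function.iterate_add_apply,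
    ← two_mul, iterate_derivative_X_sq_sub_one_pow]
  have sign : (-1) ^ n * ∫ x in (-1 : ℝ)..1, ((X ^ 2 - 1) ^ n * C ((2 * n)! : ℝ)).eval x
      = ((2 * n)! : ℝ) * ∫ x in (-1 : ℝ)..1, (1 - x ^ 2) ^ n := by
    rw [← intervalIntegral.integral_const_mul, ← intervalIntegral.integral_const_mul]
    refine intervalIntegral.integral_congr fun x _ => ?_
    simp only [eval_mul, eval_pow, eval_sub, eval_X, eval_one, eval_C]
    rw [← mul_assoc, ← mul_pow]
    ring
  rw [sign, ← mul_assoc, ← Nat.cast_mul, ← Nat.factorial_succ,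
    factorial_mul_integral_one_sub_sq_pow, mul_pow, ← pow_mul, mul_comm n 2, pow_mul]
  ring

theorem integral_legendre_mul_self (n : ℕ) :
    ∫ x, (legendre n).eval x * (legendre n).eval x ∂mu1 = 1 := by
  have square (x : ℝ) : (legendre n).eval x * (legendre n).eval x
      = (2 * n + 1 : ℕ) / (2 ^ n * (n ! : ℝ)) ^ 2 *
        (derivative^[n] ((X ^ 2 - 1 : ℝ[X]) ^ n) * derivative^[n] ((X ^ 2 - 1) ^ n)).eval x := by
    simp only [legendre, eval_mul, eval_C]
    push_cast
    linear_combination (1 / (2 ^ n * (n ! : ℝ)) ^ 2 *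
      (derivative^[n] ((X ^ 2 - 1 : ℝ[X]) ^ n)).eval x ^ 2) *
        Real.mul_self_sqrt (show (0 : ℝ) ≤ 2 * n + 1 by positivity)
  simp_rw [integral_mu1, square, intervalIntegral.integral_const_mul, div_mul_eq_mul_div]
  rw [integral_rodrigues_mul_self, smul_eq_mul]
  field_simp

/-- The `n`-th coefficient functional of the Legendre expansion of polynomials. -/
noncomputable def legendreFunctional (n : ℕ) : ℝ[X] →ₗ[ℝ] ℝ where
  toFun q := ∫ x, q.eval x * (legendre n).eval x ∂mu1
  map_add' p q := by
    simp only [eval_add, add_mul]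
    exact integral_add (integrable_mu1_of_continuous (by fun_prop))
      (integrable_mu1_of_continuous (by fun_prop))
  map_smul' a q := by
    simp only [eval_smul, smul_eq_mul, mul_assoc, RingHom.id_apply]
    exact integral_const_mul _ _

theorem legendreFunctional_apply (n : ℕ) (q : ℝ[X]) :
    legendreFunctional n q = ∫ x, q.eval x * (legendre n).eval x ∂mu1 := rfl

theorem legendreFunctional_eq_zero_of_natDegree_lt {n : ℕ} {q : ℝ[X]} (hq : q.natDegree < n) :
    legendreFunctional n q = 0 := by
  have orthogonal := integral_iterate_derivative_sq_sub_one_pow_mul le_rfl (n := n) q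
  rw [iterate_derivative_eq_zero hq] at orthogonal
  simp only [eval_mul, mul_zero, eval_zero, intervalIntegral.integral_zero] at orthogonal
  simp only [legendreFunctional_apply, integral_mu1, legendre, eval_mul, eval_C,
    mul_comm (q.eval _), mul_assoc, intervalIntegral.integral_const_mul, orthogonal, mul_zero,
    smul_zero]

theorem legendreFunctional_legendre (i j : ℕ) :
    legendreFunctional i (legendre j) = if i = j then 1 else 0 := by
  rcases lt_trichotomy i j with h | rfl | h
  · have := legendreFunctional_eq_zero_of_natDegree_lt ((natDegree_legendre i).trans_lt h)
    simp only [legendreFunctional_apply, mul_comm ((legendre i).eval _)] at this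
    rwa [if_neg h.ne]
  · rw [if_pos rfl]
    exact integral_legendre_mul_self i
  · rw [if_neg h.ne',
      legendreFunctional_eq_zero_of_natDegree_lt ((natDegree_legendre j).trans_lt h)]

theorem eq_sum_of_dual {K : Type*} [Field K] (S : Polynomial.Sequence K)
    (F : ℕ → K[X] →ₗ[K] K) (hF : ∀ i j, F i (S j) = if i = j then 1 else 0) {n : ℕ} {q : K[X]}
    (hq : q.natDegree ≤ n) : q = ∑ i ∈ Finset.range (n + 1), F i q • S i := by
  have hmem : q ∈ Submodule.span K (S '' Set.Iic n) := by
    rw [S.span_degreeLE (fun i _ => isUnit_iff_ne_zero.2 (leadingCoeff_ne_zero.2 (S.ne_zero i))),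
      mem_degreeLE]
    exact natDegree_le_iff_degree_le.1 hq
  clear hq
  induction hmem using Submodule.span_induction with
  | mem _ hx =>
    obtain ⟨j, hj, rfl⟩ := hx
    have : j < n + 1 := Nat.lt_succ_of_le hj
    simp [hF, this]
  | zero => simp
  | add p q _ _ hp hq =>
    simp only [map_add, add_smul, Finset.sum_add_distrib]
    rw [← hp, ← hq]
  | smul a p _ hp =>
    simp only [map_smul, smul_assoc, ← Finset.smul_sum]
    rw [← hp]

theorem eq_sum_legendre {n : ℕ} {q : ℝ[X]} (hq : q.natDegree ≤ n) :
    q = ∑ i ∈ Finset.range (n + 1), legendreFunctional i q • legendre i :=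
  eq_sum_of_dual { elems' := legendre, degree_eq' := degree_legendre } legendreFunctional
    legendreFunctional_legendre hq

theorem integral_abs_legendre_le_one (n : ℕ) : ∫ x, |(legendre n).eval x| ∂mu1 ≤ 1 := by
  calc ∫ x, |(legendre n).eval x| ∂mu1
      ≤ ∫ x, (1 / 2 + 1 / 2 * ((legendre n).eval x * (legendre n).eval x)) ∂mu1 := by
        refine integral_mono (integrable_mu1_of_continuous (by fun_prop))
          (integrable_mu1_of_continuous (by fun_prop)) fun x => ?_
        nlinarith [sq_nonneg (|(legendre n).eval x| - 1), sq_abs ((legendre n).eval x)]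
    _ = 1 := by
        rw [integral_add (integrable_mu1_of_continuous (by fun_prop))
          (integrable_mu1_of_continuous (by fun_prop)), integral_const_mul,
          integral_legendre_mul_self, integral_const, probReal_univ]
        norm_num

theorem abs_legendreFunctional_le_one (n : ℕ) {q : ℝ[X]}
    (hq : ∀ x ∈ Icc (-1 : ℝ) 1, |q.eval x| ≤ 1) : |legendreFunctional n q| ≤ 1 := by
  refine abs_integral_le_integral_abs.trans ((integral_mono_ae
    (integrable_mu1_of_continuous (by fun_prop)) (integrable_mu1_of_continuous (by fun_prop))
    ?_).trans (integral_abs_legendre_le_one n))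
  filter_upwards [ae_mem_Icc_mu1] with x hx
  rw [abs_mul]
  exact mul_le_of_le_one_left (abs_nonneg _) (hq x hx)

theorem abs_iterate_derivative_legendre_le (n k : ℕ) {x : ℝ} (hx : x ∈ Icc (-1 : ℝ) 1) :
    |(derivative^[k] (legendre n)).eval x| ≤ 2 * (2 * ((n : ℝ) + 1) ^ 2) ^ (k + 1) := by
  have integral_le : ∫ x in (-1 : ℝ)..1, |(C 2⁻¹ * legendre n).eval x| ≤ 1 := by
    have := integral_abs_legendre_le_one n
    rw [integral_mu1, smul_eq_mul, ← intervalIntegral.integral_const_mul] at this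
    simpa only [eval_mul, eval_C, abs_mul, abs_inv, abs_two] using this
  have := abs_eval_iterate_derivative_le_of_integral_abs_le
    ((natDegree_C_mul_le _ _).trans (natDegree_legendre n).le) integral_le k hx
  rw [iterate_derivative_C_mul, eval_mul, eval_C, abs_mul, abs_inv, abs_two] at this
  linarith

end LegendrePolynomials

section Jets

variable {n : ℕ} {ι : Type*} {F : (Fin n → ℕ) → (Fin n → ℝ) → ℂ} {U : Set (Fin n → ℝ)}

/-- The linear functional on `ℝⁿ` with prescribed values on the standard basis, that is, the
differential with prescribed partial derivatives. -/
noncomputable def differentialOfPartials (n : ℕ) : (Fin n → ℂ) ≃L[ℝ] ((Fin n → ℝ) →L[ℝ] ℂ) :=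
  (ContinuousLinearEquiv.piRing (Fin n)).symm

theorem differentialOfPartials_apply (c : Fin n → ℂ) (v : Fin n → ℝ) :
    differentialOfPartials n c v = ∑ j, v j • c j :=
  LinearEquiv.piRing_symm_apply (R := ℝ) ℝ c v

theorem differentialOfPartials_single (c : Fin n → ℂ) (j : Fin n) :
    differentialOfPartials n c (Pi.single j 1) = c j := by
  simp only [differentialOfPartials_apply, Pi.single_apply, ite_smul, one_smul, zero_smul,
    Finset.sum_ite_eq', Finset.mem_univ, if_true]

/-- A family of functions indexed by multi-indices, in which the partial derivative in the `j`-th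
direction is given by the increment of the `j`-th index. Series of jets can be summed termwise
with all their mixed derivatives at once. -/
def IsJet (F : (Fin n → ℕ) → (Fin n → ℝ) → ℂ) (U : Set (Fin n → ℝ)) : Prop :=
  ∀ α, ∀ y ∈ U,
    HasFDerivAt (F α) (differentialOfPartials n fun j => F (α + Pi.single j 1) y) y

theorem IsJet.contDiffOn (hF : IsJet F U) (hU : IsOpen U) (m : ℕ) (α : Fin n → ℕ) :
    ContDiffOn ℝ m (F α) U := by
  induction m generalizing α with
  | zero => exact contDiffOn_zero.2 fun y hy => (hF α y hy).continuousAt.continuousWithinAt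
  | succ m ih =>
    push_cast
    rw [contDiffOn_succ_iff_fderiv_of_isOpen hU]
    refine ⟨fun y hy => (hF α y hy).differentiableAt.differentiableWithinAt, by simp, ?_⟩
    refine ContDiffOn.congr ?_ fun y hy => (hF α y hy).fderiv
    exact (differentialOfPartials n).contDiff.comp_contDiffOn (contDiffOn_pi.2 fun j => ih _)

theorem IsJet.eqOn_partialDeriv (hF : IsJet F U) (hU : IsOpen U) {u : (Fin n → ℝ) → ℂ}
    {α : Fin n → ℕ} (hu : EqOn u (F α) U) (j : Fin n) :
    EqOn (partialDeriv j u) (F (α + Pi.single j 1)) U := by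
  intro y hy
  have : u =ᶠ[nhds y] F α := hu.eventuallyEq_of_mem (hU.mem_nhds hy)
  rw [partialDeriv, this.lineDeriv_eq, (hF α y hy).differentiableAt.lineDeriv_eq_fderiv,
    (hF α y hy).fderiv, differentialOfPartials_single]

theorem IsJet.eqOn_iterate_partialDeriv (hF : IsJet F U) (hU : IsOpen U) {u : (Fin n → ℝ) → ℂ}
    {α : Fin n → ℕ} (hu : EqOn u (F α) U) (j : Fin n) (i : ℕ) :
    EqOn ((partialDeriv j)^[i] u) (F (α + Pi.single j i)) U := by
  induction i with
  | zero => simpa using hu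
  | succ i ih =>
    rw [Function.iterate_succ_apply', Pi.single_add, ← add_assoc]
    exact hF.eqOn_partialDeriv hU ih j

theorem IsJet.eqOn_multiDeriv (hF : IsJet F U) (hU : IsOpen U) {u : (Fin n → ℝ) → ℂ}
    (hu : EqOn u (F 0) U) (α : Fin n → ℕ) : EqOn (multiDeriv α u) (F α) U := by
  have foldr_eq (l : List (Fin n)) : EqOn (l.foldr (fun j v => (partialDeriv j)^[α j] v) u)
      (F (l.map fun j => Pi.single j (α j)).sum) U := by
    induction l with
    | nil => simpa using hu
    | cons j l ih =>
      rw [List.foldr_cons, List.map_cons, List.sum_cons, add_comm]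
      exact hF.eqOn_iterate_partialDeriv hU ih j (α j)
  have := foldr_eq (List.finRange n)
  rwa [← List.ofFn_eq_map, List.sum_ofFn, Finset.univ_sum_single] at this

theorem IsJet.const_mul (hF : IsJet F U) (c : ℂ) : IsJet (fun α y => c * F α y) U := by
  intro α y hy
  refine ((hF α y hy).const_mul c).congr_fderiv ?_
  ext v
  simp only [_root_.smul_apply, differentialOfPartials_apply, smul_eq_mul, Finset.mul_sum,
    mul_smul_comm]

theorem IsJet.sum {F : ι → (Fin n → ℕ) → (Fin n → ℝ) → ℂ} {s : Finset ι}
    (hF : ∀ i ∈ s, IsJet (F i) U) : IsJet (fun α y => ∑ i ∈ s, F i α y) U := by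
  intro α y hy
  refine (HasFDerivAt.fun_sum fun i hi => hF i hi α y hy).congr_fderiv ?_
  rw [← map_sum]
  congr 1
  ext j
  simp

theorem IsJet.tsum {F : ι → (Fin n → ℕ) → (Fin n → ℝ) → ℂ} (hF : ∀ i, IsJet (F i) U)
    (hU : IsOpen U) (hU' : IsPreconnected U) {b : (Fin n → ℕ) → ι → ℝ}
    (hb : ∀ α, Summable (b α)) (hFb : ∀ i α, ∀ y ∈ U, ‖F i α y‖ ≤ b α i) :
    IsJet (fun α y => ∑' i, F i α y) U := by
  intro α y hy
  have summable_F (β : Fin n → ℕ) : Summable fun i => F i β y :=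
    .of_norm_bounded (hb β) fun i => hFb i β y hy
  let D : (Fin n → ℂ) →L[ℝ] ((Fin n → ℝ) →L[ℝ] ℂ) := differentialOfPartials n
  have norm_differential_le (i : ι) (x : Fin n → ℝ) (hx : x ∈ U) :
      ‖D fun j => F i (α + Pi.single j 1) x‖
        ≤ ‖D‖ * ∑ j, b (α + Pi.single j 1) i := by
    have b_nonneg (j : Fin n) : 0 ≤ b (α + Pi.single j 1) i :=
      (norm_nonneg _).trans (hFb i _ x hx)
    refine (D.le_opNorm _).trans ?_
    gcongr
    exact (pi_norm_le_iff_of_nonneg (Finset.sum_nonneg fun j _ => b_nonneg j)).2 fun j =>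
      (hFb i _ x hx).trans (Finset.single_le_sum (fun j _ => b_nonneg j) (Finset.mem_univ j))
  have tsum_differential : ∑' i, D (fun j => F i (α + Pi.single j 1) y)
      = D fun j => ∑' i, F i (α + Pi.single j 1) y :=
    ((Pi.hasSum.2 fun j => (summable_F _).hasSum).mapL D).tsum_eq
  refine HasFDerivAt.congr_fderiv ?_ tsum_differential
  exact hasFDerivAt_tsum_of_isPreconnected ((summable_sum fun j _ => hb _).mul_left _) hU hU'
    (fun i x hx => hF i α x hx) norm_differential_le hy (summable_F α) hy

/-- The mixed derivatives of the product of the one-variable polynomials `p j`, considered as a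
complex-valued function. -/
noncomputable def polyTensor (p : Fin n → ℝ[X]) (α : Fin n → ℕ) (y : Fin n → ℝ) : ℂ :=
  ((∏ j, (derivative^[α j] (p j)).eval (y j) : ℝ) : ℂ)

theorem isJet_polyTensor (p : Fin n → ℝ[X]) (U : Set (Fin n → ℝ)) : IsJet (polyTensor p) U := by
  intro α y _
  have hasFDerivAt_factor : ∀ j ∈ (Finset.univ : Finset (Fin n)),
      HasFDerivAt (fun y : Fin n → ℝ => (derivative^[α j] (p j)).eval (y j))
        ((derivative^[α j + 1] (p j)).eval (y j) •
          (ContinuousLinearMap.proj j : (Fin n → ℝ) →L[ℝ] ℝ)) y := by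
    intro j _
    rw [Function.iterate_succ_apply']
    exact ((derivative^[α j] (p j)).hasDerivAt (y j)).comp_hasFDerivAt y
      (ContinuousLinearMap.proj j : (Fin n → ℝ) →L[ℝ] ℝ).hasFDerivAt
  have polyTensor_add_single (j : Fin n) : polyTensor p (α + Pi.single j 1) y
      = (((∏ i ∈ Finset.univ.erase j, (derivative^[α i] (p i)).eval (y i)) *
        (derivative^[α j + 1] (p j)).eval (y j) : ℝ) : ℂ) := by
    rw [polyTensor, ← Finset.prod_erase_mul _ _ (Finset.mem_univ j), Pi.add_apply,
      Pi.single_eq_same]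
    congr 2
    refine Finset.prod_congr rfl fun i hi => ?_
    rw [Pi.add_apply, Pi.single_eq_of_ne (Finset.ne_of_mem_erase hi), add_zero]
  refine (Complex.ofRealCLM.hasFDerivAt.comp y
    (HasFDerivAt.finsetProd hasFDerivAt_factor)).congr_fderiv ?_
  ext v
  simp only [differentialOfPartials_apply, polyTensor_add_single, ContinuousLinearMap.comp_apply,
    _root_.sum_apply, _root_.smul_apply, map_sum, ContinuousLinearMap.proj_apply, smul_eq_mul,
    Complex.ofRealCLM_apply, Complex.real_smul]
  refine Finset.sum_congr rfl fun j _ => ?_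
  push_cast
  ring

theorem isOpen_openCube (n : ℕ) : IsOpen (openCube n) :=
  isOpen_set_pi Set.finite_univ fun _ _ => isOpen_Ioo

theorem isPreconnected_openCube (n : ℕ) : IsPreconnected (openCube n) :=
  (convex_pi fun _ _ => convex_Ioo _ _).isPreconnected

theorem IsJet.sobolevNorm_le (hF : IsJet F (openCube n)) {u : (Fin n → ℝ) → ℂ}
    (hu : EqOn u (F 0) (openCube n)) {m : ℕ} {B : ℝ}
    (hB : ∀ α, ∑ j, α j ≤ m → ∀ y ∈ openCube n, ‖F α y‖ ≤ B) :
    sobolevNorm m u ≤ ENNReal.ofReal B := by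
  refine iSup₂_le fun α hα => ?_
  rw [eLpNorm_exponent_top]
  refine eLpNormEssSup_le_of_ae_bound ?_
  filter_upwards [ae_restrict_mem (isOpen_openCube n).measurableSet] with y hy
  rw [hF.eqOn_multiDeriv (isOpen_openCube n) hu α hy]
  exact hB α hα y hy

end Jets

section Counting

variable {k : ℕ}

/-- The lattice points with nonnegative coordinates in the simplex with edge lengths `R / a j`. -/
def latticeSimplex (a : Fin k → ℝ) (R : ℝ) : Set (Fin k → ℕ) :=
  {ν | ∑ j, ν j * a j ≤ R}

theorem finite_latticeSimplex {a : Fin k → ℝ} (ha : ∀ j, 0 < a j) (R : ℝ) :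
    (latticeSimplex a R).Finite := by
  refine (Set.finite_Iic fun j => ⌊R / a j⌋₊).subset fun ν hν j => Nat.le_floor ?_
  rw [le_div_iff₀ (ha j)]
  exact (Finset.single_le_sum (f := fun j => (ν j : ℝ) * a j)
    (fun i _ => mul_nonneg (Nat.cast_nonneg _) (ha i).le) (Finset.mem_univ j)).trans hν

theorem latticeSimplex_succ_subset {a : Fin (k + 1) → ℝ} (ha : ∀ j, 0 < a j) (R : ℝ) :
    latticeSimplex a R ⊆ ⋃ i ∈ Finset.range (⌊R / a 0⌋₊ + 1),
      Fin.cons (α := fun _ => ℕ) i '' latticeSimplex (Fin.tail a) (R - i * a 0) := by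
  intro ν hν
  have sum_split : (ν 0 : ℝ) * a 0 + ∑ j : Fin k, (ν j.succ : ℝ) * a j.succ ≤ R := by
    rw [← Fin.sum_univ_succ fun j => (ν j : ℝ) * a j]
    exact hν
  have sum_tail_nonneg : 0 ≤ ∑ j : Fin k, (ν j.succ : ℝ) * a j.succ :=
    Finset.sum_nonneg fun j _ => mul_nonneg (Nat.cast_nonneg _) (ha _).le
  simp only [Set.mem_iUnion]
  refine ⟨ν 0, Finset.mem_range.2 (Nat.lt_succ_iff.2 (Nat.le_floor ?_)), Fin.tail ν, ?_,
    Fin.cons_self_tail ν⟩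
  · rw [le_div_iff₀ (ha 0)]
    linarith
  · exact le_sub_iff_add_le'.2 sum_split

theorem ncard_latticeSimplex_succ_le {a : Fin (k + 1) → ℝ} (ha : ∀ j, 0 < a j) (R : ℝ) :
    (latticeSimplex a R).ncard ≤ ∑ i ∈ Finset.range (⌊R / a 0⌋₊ + 1),
      (latticeSimplex (Fin.tail a) (R - i * a 0)).ncard := by
  have finite_slice (i : ℕ) : (latticeSimplex (Fin.tail a) (R - i * a 0)).Finite :=
    finite_latticeSimplex (fun j => ha j.succ) _
  refine (Set.ncard_le_ncard (latticeSimplex_succ_subset ha R)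
    (Set.Finite.biUnion (Finset.finite_toSet _) fun i _ => (finite_slice i).image _)).trans ?_
  exact (Finset.set_ncard_biUnion_le _ _).trans
    (Finset.sum_le_sum fun i _ => Set.ncard_image_le (finite_slice i))

theorem sum_range_mul_sub_pow_le (k : ℕ) {a : ℝ} (ha : 0 ≤ a) (N : ℕ) {Y : ℝ} (hY : N * a ≤ Y) :
    ∑ i ∈ Finset.range N, (k + 1) * a * (Y - (i + 1) * a) ^ k ≤ Y ^ (k + 1) := by
  have increment_le (i : ℕ) (hi : i ∈ Finset.range N) :
      (k + 1) * a * (Y - (i + 1) * a) ^ k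
        ≤ (Y - i * a) ^ (k + 1) - (Y - (i + 1 : ℕ) * a) ^ (k + 1) := by
    have : ((i + 1 : ℕ) : ℝ) * a ≤ N * a := by gcongr; exact Finset.mem_range.1 hi
    push_cast at this ⊢
    have bernoulli := pow_add_mul_le_add_pow (a := Y - (i + 1) * a) (b := a) (by linarith)
      (by linarith) (k + 1)
    rw [show Y - (i + 1) * a + a = Y - i * a by ring] at bernoulli
    push_cast [Nat.add_sub_cancel] at bernoulli
    linarith
  calc _ ≤ ∑ i ∈ Finset.range N, ((Y - i * a) ^ (k + 1) - (Y - (i + 1 : ℕ) * a) ^ (k + 1)) :=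
        Finset.sum_le_sum increment_le
    _ = Y ^ (k + 1) - (Y - N * a) ^ (k + 1) := by
        rw [Finset.sum_range_sub' fun i : ℕ => (Y - i * a) ^ (k + 1)]
        simp
    _ ≤ Y ^ (k + 1) := sub_le_self _ (pow_nonneg (sub_nonneg.2 hY) _)

theorem ncard_latticeSimplex_mul_le {a : Fin k → ℝ} (ha : ∀ j, 0 < a j) {R : ℝ} (hR : 0 ≤ R) :
    (latticeSimplex a R).ncard * ((k ! : ℝ) * ∏ j, a j) ≤ (R + ∑ j, a j) ^ k := by
  induction k generalizing R with
  | zero => simpa using Set.ncard_le_one_of_subsingleton (latticeSimplex a R)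
  | succ k ih =>
    have ha0 := ha 0
    have mul_le_of_mem (i : ℕ) (hi : i ∈ Finset.range (⌊R / a 0⌋₊ + 1)) : i * a 0 ≤ R := by
      rw [← le_div_iff₀ ha0]
      exact (Nat.le_floor_iff (by positivity)).1 (Nat.lt_succ_iff.1 (Finset.mem_range.1 hi))
    have sum_tail_nonneg : 0 ≤ ∑ j : Fin k, a j.succ := Finset.sum_nonneg fun j _ => (ha _).le
    calc _ ≤ ((∑ i ∈ Finset.range (⌊R / a 0⌋₊ + 1),
              (latticeSimplex (Fin.tail a) (R - i * a 0)).ncard : ℕ) : ℝ) *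
            (((k + 1)! : ℝ) * ∏ j, a j) := by
          have := Finset.prod_nonneg fun j (_ : j ∈ Finset.univ) => (ha j).le
          gcongr
          exact ncard_latticeSimplex_succ_le ha R
      _ = ∑ i ∈ Finset.range (⌊R / a 0⌋₊ + 1), (k + 1) * a 0 *
            ((latticeSimplex (Fin.tail a) (R - i * a 0)).ncard *
              ((k ! : ℝ) * ∏ j, Fin.tail a j)) := by
          rw [Nat.cast_sum, Finset.sum_mul, Fin.prod_univ_succ, Nat.factorial_succ]
          push_cast
          exact Finset.sum_congr rfl fun i _ => by simp only [Fin.tail]; ring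
      _ ≤ ∑ i ∈ Finset.range (⌊R / a 0⌋₊ + 1), (k + 1) * a 0 *
            ((R + ∑ j, a j) - (i + 1) * a 0) ^ k := by
          refine Finset.sum_le_sum fun i hi => mul_le_mul_of_nonneg_left ?_ (by positivity)
          refine (ih (fun j => ha j.succ) (sub_nonneg.2 (mul_le_of_mem i hi))).trans_eq ?_
          rw [Fin.sum_univ_succ]
          ring
      _ ≤ (R + ∑ j, a j) ^ (k + 1) := by
          refine sum_range_mul_sub_pow_le k ha0.le _ ?_
          have := mul_le_of_mem _ (Finset.self_mem_range_succ _)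
          rw [Fin.sum_univ_succ]
          push_cast
          linarith

variable {d : ℕ} {ξ : Fin (d + 1) → ℝ}

theorem gamma_le_prod (hξ : ∀ j, 1 ≤ ξ j) (ν : Fin (d + 1) → ℕ) :
    gamma ξ ν ≤ ∏ j, (ξ j ^ ν j)⁻¹ := by
  have ξ_pos (j : Fin (d + 1)) : 0 < ξ j := zero_lt_one.trans_le (hξ j)
  rw [gamma, Fin.prod_univ_castSucc, mul_comm]
  refine mul_le_mul_of_nonneg_left (inv_anti₀ (pow_pos (ξ_pos _) _) ?_)
    (Finset.prod_nonneg fun j _ => inv_nonneg.2 (pow_pos (ξ_pos _) _).le)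
  exact pow_le_pow_right₀ (hξ _) (le_max_right _ _)

theorem indexSet_subset_latticeSimplex (hξ : ∀ j, 1 ≤ ξ j) {ε : ℝ} (hε : 0 < ε) :
    indexSet ξ ε ⊆ latticeSimplex (fun j => Real.log (ξ j)) (-Real.log ε) := by
  intro ν (hν : ε ≤ gamma ξ ν)
  have log_le := Real.log_le_log hε (hν.trans (gamma_le_prod hξ ν))
  rw [Real.log_prod fun j _ =>
    inv_ne_zero (pow_ne_zero _ (zero_lt_one.trans_le (hξ j)).ne')] at log_le
  simp only [Real.log_inv, Real.log_pow, Finset.sum_neg_distrib] at log_le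
  exact le_neg_of_le_neg log_le

theorem finite_indexSet (hξ : ∀ j, 1 < ξ j) {ε : ℝ} (hε : 0 < ε) : (indexSet ξ ε).Finite :=
  (finite_latticeSimplex (fun j => Real.log_pos (hξ j)) _).subset
    (indexSet_subset_latticeSimplex (fun j => (hξ j).le) hε)

theorem beta_mul_ncard_indexSet_rpow_le (hξ : ∀ j, 1 < ξ j) {ε : ℝ} (hε : 0 < ε) (hε1 : ε ≤ 1) :
    beta ξ * ((indexSet ξ ε).ncard : ℝ) ^ (1 / ((d + 1 : ℕ) : ℝ))
      ≤ -Real.log ε + ∑ j, Real.log (ξ j) := by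
  have log_pos (j : Fin (d + 1)) : 0 < Real.log (ξ j) := Real.log_pos (hξ j)
  have neg_log_ε_nonneg : 0 ≤ -Real.log ε := neg_nonneg.2 (Real.log_nonpos hε.le hε1)
  have sum_log_nonneg : 0 ≤ ∑ j, Real.log (ξ j) := Finset.sum_nonneg fun j _ => (log_pos j).le
  have volume_nonneg : 0 ≤ ((d + 1)! : ℝ) * ∏ j, Real.log (ξ j) :=
    mul_nonneg (Nat.cast_nonneg _) (Finset.prod_nonneg fun j _ => (log_pos j).le)
  have ncard_mul_le : (indexSet ξ ε).ncard * (((d + 1)! : ℝ) * ∏ j, Real.log (ξ j))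
      ≤ (-Real.log ε + ∑ j, Real.log (ξ j)) ^ (d + 1) := by
    refine le_trans ?_ (ncard_latticeSimplex_mul_le log_pos neg_log_ε_nonneg)
    gcongr
    exacts [finite_latticeSimplex log_pos _,
      indexSet_subset_latticeSimplex (fun j => (hξ j).le) hε]
  rw [beta, ← Real.mul_rpow volume_nonneg (Nat.cast_nonneg _), mul_comm]
  refine (Real.rpow_le_rpow (by positivity) ncard_mul_le (by positivity)).trans_eq ?_
  rw [one_div, Real.pow_rpow_inv_natCast (by positivity) (by omega)]

theorem rpow_le_exp_mul_prod (hξ : ∀ j, 1 < ξ j) {ε : ℝ} (hε : 0 < ε) (hε1 : ε ≤ 1) {τ : ℝ}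
    (hτ : τ ∈ Icc (0 : ℝ) 1) :
    ε ^ τ ≤ Real.exp (-τ * beta ξ * ((indexSet ξ ε).ncard : ℝ) ^ (1 / ((d + 1 : ℕ) : ℝ))) *
      ∏ j, ξ j := by
  have sum_log_nonneg : 0 ≤ ∑ j, Real.log (ξ j) :=
    Finset.sum_nonneg fun j _ => (Real.log_pos (hξ j)).le
  have prod_eq_exp : ∏ j, ξ j = Real.exp (∑ j, Real.log (ξ j)) := by
    rw [Real.exp_sum]
    exact Finset.prod_congr rfl fun j _ => (Real.exp_log (zero_lt_one.trans (hξ j))).symm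
  rw [prod_eq_exp, ← Real.exp_add, Real.rpow_def_of_pos hε]
  refine Real.exp_le_exp.2 ?_
  linear_combination
    mul_le_mul_of_nonneg_left (beta_mul_ncard_indexSet_rpow_le hξ hε hε1) hτ.1 +
      mul_le_mul_of_nonneg_right hτ.2 sum_log_nonneg

end Counting

section BernsteinEllipse

/-- The Joukowski map, under which the Bernstein ellipse with parameter `ρ` is the image of the
annulus `1 ≤ ‖z‖ ≤ ρ`. -/
noncomputable def joukowski (z : ℂ) : ℂ := (z + z⁻¹) / 2

theorem norm_joukowski_sub_add {z : ℂ} (hz : z ≠ 0) :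
    ‖joukowski z - 1‖ + ‖joukowski z + 1‖ = ‖z‖ + ‖z‖⁻¹ := by
  have sub_one_eq : joukowski z - 1 = (z - 1) ^ 2 / (2 * z) := by
    rw [joukowski]; field_simp; ring
  have add_one_eq : joukowski z + 1 = (z + 1) ^ 2 / (2 * z) := by
    rw [joukowski]; field_simp; ring
  have parallelogram := parallelogram_law_with_norm ℝ z 1
  rw [norm_one] at parallelogram
  have norm_ne_zero : ‖z‖ ≠ 0 := norm_ne_zero_iff.2 hz
  rw [sub_one_eq, add_one_eq, norm_div, norm_div, norm_pow, norm_pow, norm_mul,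
    Complex.norm_ofNat]
  field_simp
  linear_combination parallelogram

theorem joukowski_inv (z : ℂ) : joukowski z⁻¹ = joukowski z := by
  rw [joukowski, joukowski, inv_inv, add_comm]

theorem joukowski_of_norm_eq_one {z : ℂ} (hz : ‖z‖ = 1) : joukowski z = (z.re : ℂ) := by
  rw [joukowski, Complex.inv_eq_conj hz, Complex.add_conj]
  push_cast
  ring

theorem differentiableAt_joukowski {z : ℂ} (hz : z ≠ 0) : DifferentiableAt ℂ joukowski z := by
  unfold joukowski
  fun_prop (disch := exact hz)

theorem exists_joukowski_eq (w : ℂ) : ∃ z : ℂ, z ≠ 0 ∧ 1 ≤ ‖z‖ ∧ joukowski z = w := by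
  obtain ⟨s, hs⟩ := IsAlgClosed.exists_pow_nat_eq (w ^ 2 - 1) two_pos
  have mul_sub_eq_one : (w + s) * (w - s) = 1 := by linear_combination -hs
  have ne_zero : w + s ≠ 0 := left_ne_zero_of_mul_eq_one mul_sub_eq_one
  have joukowski_eq : joukowski (w + s) = w := by
    rw [joukowski, inv_eq_of_mul_eq_one_right mul_sub_eq_one]
    ring
  rcases le_total 1 ‖w + s‖ with one_le | le_one
  · exact ⟨w + s, ne_zero, one_le, joukowski_eq⟩
  · refine ⟨(w + s)⁻¹, inv_ne_zero ne_zero, ?_, by rw [joukowski_inv, joukowski_eq]⟩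
    rw [norm_inv]
    exact one_le_inv_iff₀.2 ⟨norm_pos_iff.2 ne_zero, le_one⟩

theorem add_inv_lt_add_inv {a b : ℝ} (ha : 0 < a) (hab : a < b) (h : 1 < a * b) :
    a + a⁻¹ < b + b⁻¹ := by
  have hb : 0 < b := ha.trans hab
  have factorization : b + b⁻¹ - (a + a⁻¹) = (b - a) * (1 - (a * b)⁻¹) := by
    field_simp
    ring
  have := mul_pos (sub_pos.2 hab) (sub_pos.2 (inv_lt_one_of_one_lt₀ h))
  linarith

theorem strictMonoOn_add_inv : StrictMonoOn (fun x : ℝ => x + x⁻¹) (Ici 1) :=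
  fun _ ha _ _ hab => add_inv_lt_add_inv (zero_lt_one.trans_le ha) hab
    (one_lt_mul_of_le_of_lt ha (lt_of_le_of_lt ha hab))

theorem mem_bernsteinEllipse_iff {ρ : ℝ} (hρ : 1 ≤ ρ) {w : ℂ} :
    w ∈ bernsteinEllipse ρ ↔ ‖w - 1‖ + ‖w + 1‖ ≤ ρ + ρ⁻¹ := by
  constructor
  · rintro ⟨z, ⟨one_le, le_ρ⟩, rfl⟩
    change ‖joukowski z - 1‖ + ‖joukowski z + 1‖ ≤ _
    rw [norm_joukowski_sub_add (norm_pos_iff.1 (zero_lt_one.trans_le one_le))]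
    exact (strictMonoOn_add_inv.le_iff_le one_le hρ).2 le_ρ
  · intro h
    obtain ⟨z, hz, one_le, rfl⟩ := exists_joukowski_eq w
    rw [norm_joukowski_sub_add hz] at h
    exact ⟨z, ⟨one_le, (strictMonoOn_add_inv.le_iff_le one_le hρ).1 h⟩, rfl⟩

theorem joukowski_mem_interior_bernsteinEllipse {ρ : ℝ} (hρ : 1 < ρ) {z : ℂ}
    (hz : ‖z‖ ∈ Ioo ρ⁻¹ ρ) : joukowski z ∈ interior (bernsteinEllipse ρ) := by
  have norm_z_pos : 0 < ‖z‖ := (inv_pos.2 (zero_lt_one.trans hρ)).trans hz.1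
  refine mem_interior.2 ⟨{w | ‖w - 1‖ + ‖w + 1‖ < ρ + ρ⁻¹}, fun w hw =>
    (mem_bernsteinEllipse_iff hρ.le).2 (le_of_lt hw), isOpen_lt (by fun_prop) (by fun_prop), ?_⟩
  rw [mem_ofPred_eq, norm_joukowski_sub_add (norm_pos_iff.1 norm_z_pos)]
  exact add_inv_lt_add_inv norm_z_pos hz.2 ((inv_lt_iff_one_lt_mul₀ (zero_lt_one.trans hρ)).1 hz.1)

theorem one_mem_Ioo_inv_self {ρ : ℝ} (hρ : 1 < ρ) : (1 : ℝ) ∈ Ioo ρ⁻¹ ρ :=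
  ⟨inv_lt_one_of_one_lt₀ hρ, hρ⟩

end BernsteinEllipse

section ContourShift

variable {k : ℕ}

theorem toCircle_coe (t : ℝ) :
    (AddCircle.toCircle (t : UnitAddCircle) : ℂ)
      = Complex.exp ((2 * Real.pi * t : ℝ) * Complex.I) := by
  rw [AddCircle.toCircle_apply_mk, Circle.coe_exp, div_one]

theorem integral_comp_mul_toCircle (G : ℂ → ℂ) (s : ℝ) :
    ∫ x : UnitAddCircle, G (s * x.toCircle) ∂AddCircle.haarAddCircle
      = Real.circleAverage G 0 s := by
  have substitution := intervalIntegral.integral_comp_mul_left (a := 0) (b := 1)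
    (fun θ => G (circleMap 0 s θ)) (c := 2 * Real.pi) (by positivity)
  rw [mul_zero, mul_one] at substitution
  rw [AddCircle.integral_haarAddCircle, inv_one, one_smul,
    ← AddCircle.intervalIntegral_preimage 1 0, zero_add, Real.circleAverage, ← substitution]
  simp only [toCircle_coe, circleMap, zero_add]

theorem integral_comp_mul_toCircle_eq {G : ℂ → ℂ} {a b : ℝ} (ha : 0 ≤ a)
    (hG : ∀ z : ℂ, ‖z‖ ∈ Ioo a b → DifferentiableAt ℂ G z) {s t : ℝ} (hs : s ∈ Ioo a b)
    (ht : t ∈ Ioo a b) :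
    ∫ x : UnitAddCircle, G (s * x.toCircle) ∂AddCircle.haarAddCircle
      = ∫ x : UnitAddCircle, G (t * x.toCircle) ∂AddCircle.haarAddCircle := by
  wlog hst : s ≤ t generalizing s t
  · exact (this ht hs (le_of_not_ge hst)).symm
  have hs0 : 0 < s := ha.trans_lt hs.1
  have ht0 : 0 < t := ha.trans_lt ht.1
  rw [integral_comp_mul_toCircle, integral_comp_mul_toCircle,
    Real.circleAverage_eq_circleIntegral hs0.ne', Real.circleAverage_eq_circleIntegral ht0.ne',
    Complex.circleIntegral_sub_center_inv_smul_eq_of_differentiable_on_annulus_off_countable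
      hs0 hst Set.countable_empty]
  · rintro z ⟨norm_le, norm_ge⟩
    rw [mem_closedBall_zero_iff] at norm_le
    rw [mem_ball_zero_iff, not_lt] at norm_ge
    exact (hG z ⟨hs.1.trans_le norm_ge, norm_le.trans_lt ht.2⟩).continuousAt.continuousWithinAt
  · rintro z ⟨⟨norm_lt, norm_gt⟩, -⟩
    rw [mem_ball_zero_iff] at norm_lt
    rw [mem_closedBall_zero_iff, not_le] at norm_gt
    exact hG z ⟨hs.1.trans norm_gt, norm_lt.trans ht.2⟩

/-- The Haar probability measure on the torus. It is the measure with respect to which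
`UnitAddTorus.mFourierCoeff` is defined, where it is only a local instance. -/
noncomputable def torusMeasure (k : ℕ) : Measure (UnitAddTorus (Fin k)) :=
  Measure.pi fun _ => AddCircle.haarAddCircle

instance isProbabilityMeasure_torusMeasure (k : ℕ) : IsProbabilityMeasure (torusMeasure k) := by
  unfold torusMeasure
  infer_instance

/-- The point of `ℂᵏ` whose coordinates have the moduli `s j` and the angles `x j`. -/
noncomputable def torusPoint (s : Fin k → ℝ) (x : UnitAddTorus (Fin k)) : Fin k → ℂ :=
  fun j => s j * (x j).toCircle

theorem continuous_torusPoint (s : Fin k → ℝ) : Continuous (torusPoint s) :=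
  continuous_pi fun j => continuous_const.mul (continuous_subtype_val.comp
    (AddCircle.continuous_toCircle.comp (continuous_apply j)))

theorem norm_torusPoint_apply {s : Fin k → ℝ} {j : Fin k} (hs : 0 ≤ s j)
    (x : UnitAddTorus (Fin k)) : ‖torusPoint s x j‖ = s j := by
  rw [torusPoint, norm_mul, Circle.norm_coe, mul_one, Complex.norm_real, Real.norm_of_nonneg hs]

/-- The product of the open annuli with inner radii `a j` and outer radii `b j`. -/
def polyannulus (a b : Fin k → ℝ) : Set (Fin k → ℂ) := {z | ∀ j, ‖z j‖ ∈ Ioo (a j) (b j)}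

variable {Φ : (Fin k → ℂ) → ℂ} {a b s t : Fin k → ℝ}

theorem torusPoint_mem_polyannulus (ha : ∀ j, 0 ≤ a j) (hs : ∀ j, s j ∈ Ioo (a j) (b j))
    (x : UnitAddTorus (Fin k)) : torusPoint s x ∈ polyannulus a b := fun j => by
  rw [norm_torusPoint_apply ((ha j).trans (hs j).1.le)]
  exact hs j

theorem continuous_comp_torusPoint (ha : ∀ j, 0 ≤ a j)
    (hΦ : ∀ z ∈ polyannulus a b, DifferentiableAt ℂ Φ z) (hs : ∀ j, s j ∈ Ioo (a j) (b j)) :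
    Continuous fun x => Φ (torusPoint s x) :=
  continuous_iff_continuousAt.2 fun x =>
    ContinuousAt.comp (hΦ _ (torusPoint_mem_polyannulus ha hs x)).continuousAt
      (continuous_torusPoint s).continuousAt

theorem integral_torusMeasure_succ {F : UnitAddTorus (Fin (k + 1)) → ℂ} (hF : Continuous F)
    (j : Fin (k + 1)) :
    ∫ x, F x ∂torusMeasure (k + 1)
      = ∫ y, ∫ x, F (Fin.insertNth (α := fun _ => UnitAddCircle) j x y) ∂AddCircle.haarAddCircle
          ∂torusMeasure k := by
  have continuous_insertNth : Continuous fun p : UnitAddCircle × UnitAddTorus (Fin k) =>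
      F (Fin.insertNth (α := fun _ => UnitAddCircle) j p.1 p.2) :=
    hF.comp (Continuous.finInsertNth j continuous_fst continuous_snd)
  rw [← integral_prod_symm _ (integrableOn_univ.1
    (continuous_insertNth.continuousOn.integrableOn_compact isCompact_univ))]
  exact ((measurePreserving_piFinSuccAbove (fun _ : Fin (k + 1) => AddCircle.haarAddCircle)
    j).symm.integral_comp (MeasurableEquiv.measurableEmbedding _) F).symm

theorem torusPoint_update_insertNth (s : Fin (k + 1) → ℝ) (j : Fin (k + 1)) (r : ℝ)
    (x : UnitAddCircle) (y : UnitAddTorus (Fin k)) :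
    torusPoint (Function.update s j r) (Fin.insertNth (α := fun _ => UnitAddCircle) j x y)
      = Function.update (torusPoint s (Fin.insertNth (α := fun _ => UnitAddCircle) j 0 y)) j
          (r * x.toCircle) := by
  ext i
  refine Fin.succAboveCases j ?_ (fun i => ?_) i <;> simp [torusPoint]

theorem update_mem_Ioo (hs : ∀ j, s j ∈ Ioo (a j) (b j)) {j : Fin k} {r : ℝ}
    (hr : r ∈ Ioo (a j) (b j)) (i : Fin k) : Function.update s j r i ∈ Ioo (a i) (b i) := by
  rcases eq_or_ne i j with rfl | hij
  · rwa [Function.update_self]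
  · rw [Function.update_of_ne hij]
    exact hs i

theorem update_mem_polyannulus {z : Fin k → ℂ} (hz : z ∈ polyannulus a b) {j : Fin k} {w : ℂ}
    (hw : ‖w‖ ∈ Ioo (a j) (b j)) : Function.update z j w ∈ polyannulus a b := fun i => by
  rcases eq_or_ne i j with rfl | hij
  · rwa [Function.update_self]
  · rw [Function.update_of_ne hij]
    exact hz i

theorem integral_comp_torusPoint_update (ha : ∀ j, 0 ≤ a j)
    (hΦ : ∀ z ∈ polyannulus a b, DifferentiableAt ℂ Φ z) (hs : ∀ j, s j ∈ Ioo (a j) (b j))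
    (j : Fin k) {r : ℝ} (hr : r ∈ Ioo (a j) (b j)) :
    ∫ x, Φ (torusPoint (Function.update s j r) x) ∂torusMeasure k
      = ∫ x, Φ (torusPoint s x) ∂torusMeasure k := by
  obtain _ | k := k
  · exact j.elim0
  conv_rhs => rw [← Function.update_eq_self j s]
  rw [integral_torusMeasure_succ
      (continuous_comp_torusPoint ha hΦ (update_mem_Ioo hs hr)) j,
    integral_torusMeasure_succ
      (continuous_comp_torusPoint ha hΦ (update_mem_Ioo hs (hs j))) j]
  simp only [torusPoint_update_insertNth]
  refine integral_congr_ae (.of_forall fun y => ?_)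
  refine integral_comp_mul_toCircle_eq (G := fun w => Φ (Function.update _ j w)) (ha j)
    (fun w hw => ?_) hr (hs j)
  exact (hΦ _ (update_mem_polyannulus (torusPoint_mem_polyannulus ha hs _) hw)).comp w
    (hasFDerivAt_update (𝕜 := ℂ) (E := fun _ => ℂ) _ w).differentiableAt

theorem integral_comp_torusPoint_eq (ha : ∀ j, 0 ≤ a j)
    (hΦ : ∀ z ∈ polyannulus a b, DifferentiableAt ℂ Φ z) (hs : ∀ j, s j ∈ Ioo (a j) (b j))
    (ht : ∀ j, t j ∈ Ioo (a j) (b j)) :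
    ∫ x, Φ (torusPoint s x) ∂torusMeasure k = ∫ x, Φ (torusPoint t x) ∂torusMeasure k := by
  have integral_piecewise (S : Finset (Fin k)) :
      ∫ x, Φ (torusPoint (S.piecewise s t) x) ∂torusMeasure k
        = ∫ x, Φ (torusPoint t x) ∂torusMeasure k := by
    induction S using Finset.induction_on with
    | empty => rw [Finset.piecewise_empty]
    | insert j S _ ih =>
      have piecewise_mem (i : Fin k) : S.piecewise s t i ∈ Ioo (a i) (b i) :=
        Finset.piecewise_cases S s t (· ∈ Ioo (a i) (b i)) (hs i) (ht i)
      rw [Finset.piecewise_insert,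
        integral_comp_torusPoint_update ha hΦ piecewise_mem j (hs j), ih]
  simpa only [Finset.piecewise_univ] using integral_piecewise Finset.univ

end ContourShift

section ChebyshevExpansion

variable {k : ℕ} {ξ : Fin k → ℝ} {f : (Fin k → ℂ) → ℂ}

theorem eval_T_joukowski {z : ℂ} (hz : z ≠ 0) (n : ℤ) :
    (Chebyshev.T ℂ n).eval (joukowski z) = joukowski (z ^ n) := by
  induction n using Chebyshev.induct with
  | zero => simp [joukowski]
  | one => simp
  | add_two n ih1 ih0 =>
    rw [Chebyshev.T_add_two]
    simp only [eval_sub, eval_mul, eval_ofNat, eval_X, ih1, ih0]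
    simp only [joukowski, zpow_add₀ hz, zpow_natCast, zpow_ofNat]
    field_simp
    ring
  | neg_add_one n ih0 ih1 =>
    rw [Chebyshev.T_sub_one]
    simp only [eval_sub, eval_mul, eval_ofNat, eval_X, ih1, ih0]
    simp only [joukowski, zpow_add₀ hz, zpow_sub₀ hz, zpow_neg, zpow_one, zpow_natCast]
    field_simp
    ring

theorem sum_units_prod_zpow {z : Fin k → ℂ} (hz : ∀ j, z j ≠ 0) (n : Fin k → ℤ) :
    ∑ σ : Fin k → ℤˣ, ∏ j, (z j ^ (σ j : ℤ)) ^ n j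
      = 2 ^ k * ∏ j, (Chebyshev.T ℂ (n j)).eval (joukowski (z j)) := by
  have sum_units (j : Fin k) : ∑ u : ℤˣ, (z j ^ (u : ℤ)) ^ n j
      = 2 * (Chebyshev.T ℂ (n j)).eval (joukowski (z j)) := by
    rw [eval_T_joukowski (hz j), UnitsInt.univ, Finset.sum_pair (by decide), joukowski]
    simp only [Units.val_one, zpow_one, Units.val_neg, zpow_neg, inv_zpow]
    ring
  rw [← Fintype.piFinset_univ,
    ← Finset.prod_univ_sum (fun _ => Finset.univ) fun j (u : ℤˣ) => (z j ^ (u : ℤ)) ^ n j]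
  simp only [sum_units, Finset.prod_mul_distrib, Finset.prod_const, Finset.card_univ,
    Fintype.card_fin]

theorem joukowski_zpow_units (z : ℂ) (u : ℤˣ) : joukowski (z ^ (u : ℤ)) = joukowski z := by
  rcases Int.units_eq_one_or u with rfl | rfl <;> simp [joukowski_inv]

theorem exists_joukowski_toCircle_eq {y : ℝ} (hy : y ∈ Icc (-1 : ℝ) 1) :
    ∃ x : UnitAddCircle, joukowski x.toCircle = y := by
  refine ⟨((Real.arccos y / (2 * Real.pi) : ℝ) : UnitAddCircle), ?_⟩
  rw [joukowski_of_norm_eq_one (Circle.norm_coe _), toCircle_coe,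
    mul_div_cancel₀ _ (by positivity), Complex.exp_ofReal_mul_I_re, Real.cos_arccos hy.1 hy.2]

theorem exists_eq_joukowski_toCircle (x : UnitAddCircle) :
    ∃ y ∈ Icc (-1 : ℝ) 1, joukowski x.toCircle = y := by
  refine ⟨(x.toCircle : ℂ).re, abs_le.1 ?_, joukowski_of_norm_eq_one (Circle.norm_coe _)⟩
  exact (Complex.abs_re_le_norm _).trans_eq (Circle.norm_coe _)

/-- On the cube `[-1,1]ᵏ`, `f` is the sum of the absolutely convergent Chebyshev series with
coefficients `c`. The series runs over all integer multi-indices, as suits coefficients that come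
from a Fourier series; the terms with indices `n j` and `-n j` belong to the same polynomial. -/
structure HasChebyshevExpansion (f : (Fin k → ℂ) → ℂ) (c : (Fin k → ℤ) → ℂ) : Prop where
  summable : Summable c
  hasSum (y : Fin k → ℝ) (hy : ∀ j, y j ∈ Icc (-1 : ℝ) 1) :
    HasSum (fun n => c n * ((∏ j, (Chebyshev.T ℝ (n j)).eval (y j) : ℝ) : ℂ)) (f (toComplex y))

/-- The coefficients of the Chebyshev expansion of `f`: the Fourier coefficients of `f`
composed with the Joukowski map. -/
noncomputable def chebyshevCoeff (f : (Fin k → ℂ) → ℂ) (n : Fin k → ℤ) : ℂ :=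
  UnitAddTorus.mFourierCoeff
    (fun x : UnitAddTorus (Fin k) => f fun j => joukowski (x j).toCircle) n

theorem mFourier_apply_eq_prod (n : Fin k → ℤ) (x : UnitAddTorus (Fin k)) :
    UnitAddTorus.mFourier n x = ∏ j, ((x j).toCircle : ℂ) ^ n j := by
  change ∏ j, fourier (n j) (x j) = _
  refine Finset.prod_congr rfl fun j _ => ?_
  rw [fourier_apply, AddCircle.toCircle_zsmul, Circle.coe_zpow]

theorem hasSum_chebyshevCoeff_mul_prod_zpow
    (hf : Continuous fun x : UnitAddTorus (Fin k) => f fun j => joukowski (x j).toCircle)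
    (hs : Summable (chebyshevCoeff f)) (x : UnitAddTorus (Fin k)) :
    HasSum (fun n => chebyshevCoeff f n * ∏ j, ((x j).toCircle : ℂ) ^ n j)
      (f fun j => joukowski (x j).toCircle) := by
  simpa only [smul_eq_mul, mFourier_apply_eq_prod] using!
    UnitAddTorus.hasSum_mFourier_series_apply_of_summable (f := ⟨_, hf⟩) hs x

theorem hasChebyshevExpansion_chebyshevCoeff
    (hf : Continuous fun x : UnitAddTorus (Fin k) => f fun j => joukowski (x j).toCircle)
    (hs : Summable (chebyshevCoeff f)) : HasChebyshevExpansion f (chebyshevCoeff f) := by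
  refine ⟨hs, fun y hy => ?_⟩
  choose x hx using fun j => exists_joukowski_toCircle_eq (hy j)
  have hasSum_reflected (σ : Fin k → ℤˣ) : HasSum
      (fun n => chebyshevCoeff f n * ∏ j, ((x j).toCircle ^ (σ j : ℤ) : ℂ) ^ n j)
      (f (toComplex y)) := by
    have := hasSum_chebyshevCoeff_mul_prod_zpow hf hs fun j => (σ j : ℤ) • x j
    simpa only [AddCircle.toCircle_zsmul, Circle.coe_zpow, joukowski_zpow_units, hx] using! this
  -- Averaging over all reflections `x j ↦ ± x j` turns the exponentials into cosines.
  have hasSum_sum_reflected := hasSum_sum (s := Finset.univ) fun σ _ => hasSum_reflected σ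
  simp only [← Finset.mul_sum, sum_units_prod_zpow fun _ => Circle.coe_ne_zero _, hx,
    ← Chebyshev.complex_ofReal_eval_T, ← Complex.ofReal_prod, Finset.sum_const, Finset.card_univ,
    Fintype.card_pi, Fintype.card_units_int, Finset.prod_const, Fintype.card_fin, nsmul_eq_mul,
    Nat.cast_pow, Nat.cast_ofNat, mul_left_comm _ ((2 : ℂ) ^ k)] at hasSum_sum_reflected
  exact (hasSum_mul_left_iff (pow_ne_zero k two_ne_zero)).1 hasSum_sum_reflected

theorem polyellipse_eq_pi (ξ : Fin k → ℝ) :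
    polyellipse ξ = Set.univ.pi fun j => bernsteinEllipse (ξ j) := by
  ext z
  simp only [polyellipse, mem_ofPred_eq, mem_univ_pi]

theorem joukowski_mem_interior_polyellipse (hξ : ∀ j, 1 < ξ j) {z : Fin k → ℂ}
    (hz : z ∈ polyannulus (fun j => (ξ j)⁻¹) ξ) :
    (fun j => joukowski (z j)) ∈ interior (polyellipse ξ) := by
  rw [polyellipse_eq_pi, interior_pi_set Set.finite_univ]
  exact fun j _ => joukowski_mem_interior_bernsteinEllipse (hξ j) (hz j)

theorem ne_zero_of_mem_polyannulus {a b : Fin k → ℝ} (ha : ∀ j, 0 ≤ a j) {z : Fin k → ℂ}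
    (hz : z ∈ polyannulus a b) (j : Fin k) : z j ≠ 0 :=
  norm_pos_iff.1 ((ha j).trans_lt (hz j).1)

theorem differentiableAt_comp_joukowski (hξ : ∀ j, 1 < ξ j)
    (hf : DifferentiableOn ℂ f (interior (polyellipse ξ))) {z : Fin k → ℂ}
    (hz : z ∈ polyannulus (fun j => (ξ j)⁻¹) ξ) :
    DifferentiableAt ℂ (fun z : Fin k → ℂ => f fun j => joukowski (z j)) z := by
  have ne_zero := ne_zero_of_mem_polyannulus
    (fun j => inv_nonneg.2 (zero_le_one.trans (hξ j).le)) hz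
  refine DifferentiableAt.comp z (hf.differentiableAt
    (isOpen_interior.mem_nhds (joukowski_mem_interior_polyellipse hξ hz)))
    (differentiableAt_pi.2 fun j => ?_)
  have differentiableAt_coord : DifferentiableAt ℂ (fun z : Fin k → ℂ => z j) z :=
    differentiableAt_apply j z
  exact (differentiableAt_joukowski (ne_zero j)).comp z differentiableAt_coord

theorem torusPoint_one (x : UnitAddTorus (Fin k)) :
    torusPoint 1 x = fun j => ((x j).toCircle : ℂ) := by
  ext j
  simp [torusPoint]

theorem continuous_comp_joukowski_toCircle (hξ : ∀ j, 1 < ξ j)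
    (hf : DifferentiableOn ℂ f (interior (polyellipse ξ))) :
    Continuous fun x : UnitAddTorus (Fin k) => f fun j => joukowski (x j).toCircle := by
  have := continuous_comp_torusPoint (s := 1)
    (fun j => inv_nonneg.2 (zero_le_one.trans (hξ j).le))
    (fun z hz => differentiableAt_comp_joukowski hξ hf hz) (fun j => one_mem_Ioo_inv_self (hξ j))
  simpa only [torusPoint_one] using! this

theorem chebyshevCoeff_eq_integral_torusPoint (hξ : ∀ j, 1 < ξ j)
    (hf : DifferentiableOn ℂ f (interior (polyellipse ξ))) (n : Fin k → ℤ) {s : Fin k → ℝ}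
    (hs : ∀ j, s j ∈ Ioo (ξ j)⁻¹ (ξ j)) :
    chebyshevCoeff f n = ∫ x, (∏ j, torusPoint s x j ^ (-n j)) *
      f (fun j => joukowski (torusPoint s x j)) ∂torusMeasure k := by
  have ξ_inv_nonneg (j : Fin k) : 0 ≤ (ξ j)⁻¹ := inv_nonneg.2 (zero_le_one.trans (hξ j).le)
  have differentiableAt_integrand (z : Fin k → ℂ) (hz : z ∈ polyannulus (fun j => (ξ j)⁻¹) ξ) :
      DifferentiableAt ℂ
        (fun z : Fin k → ℂ => (∏ j, z j ^ (-n j)) * f fun j => joukowski (z j)) z := by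
    refine DifferentiableAt.mul ?_ (differentiableAt_comp_joukowski hξ hf hz)
    exact (HasFDerivAt.finsetProd fun j _ => ((differentiableAt_apply j z).zpow (m := -n j)
      (Or.inl (ne_zero_of_mem_polyannulus ξ_inv_nonneg hz j))).hasFDerivAt).differentiableAt
  rw [← integral_comp_torusPoint_eq ξ_inv_nonneg differentiableAt_integrand
    (fun j => one_mem_Ioo_inv_self (hξ j)) hs]
  refine Eq.trans (b := ∫ x, UnitAddTorus.mFourier (-n) x *
    f (fun j => joukowski (x j).toCircle) ∂torusMeasure k) rfl ?_
  simp only [mFourier_apply_eq_prod, Pi.neg_apply]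
  exact integral_congr_ae (.of_forall fun x => by simp [torusPoint])

theorem zpow_sign_mem_Ioo {t ρ : ℝ} (ht : t ∈ Ioo 1 ρ) (i : ℤ) : t ^ i.sign ∈ Ioo ρ⁻¹ ρ := by
  have one_lt := ht.1.trans ht.2
  rcases lt_trichotomy i 0 with neg | rfl | pos
  · rw [Int.sign_eq_neg_one_of_neg neg, zpow_neg_one]
    exact ⟨inv_strictAnti₀ (zero_lt_one.trans ht.1) ht.2,
      (inv_lt_one_of_one_lt₀ ht.1).trans one_lt⟩
  · rw [Int.sign_zero, zpow_zero]
    exact one_mem_Ioo_inv_self one_lt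
  · rw [Int.sign_eq_one_of_pos pos, zpow_one]
    exact ⟨(inv_lt_one_of_one_lt₀ one_lt).trans ht.1, ht.2⟩

theorem norm_torusPoint_zpow_sign {t : Fin k → ℝ} {n : Fin k → ℤ} {j : Fin k} (ht : 0 ≤ t j)
    (x : UnitAddTorus (Fin k)) :
    ‖torusPoint (fun j => t j ^ (n j).sign) x j ^ (-n j)‖ = (t j ^ (n j).natAbs)⁻¹ := by
  rw [norm_zpow, norm_torusPoint_apply (zpow_nonneg ht _), ← zpow_mul, mul_neg,
    Int.sign_mul_self_eq_abs, zpow_neg, Int.abs_eq_natAbs, zpow_natCast]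

theorem norm_chebyshevCoeff_le_of_radii (hξ : ∀ j, 1 < ξ j)
    (hf : DifferentiableOn ℂ f (interior (polyellipse ξ))) {n : Fin k → ℤ} {B : ℝ}
    (hB : ∀ z ∈ interior (polyellipse ξ),
      (∀ j, n j = 0 → ∃ y ∈ Icc (-1 : ℝ) 1, z j = y) → ‖f z‖ ≤ B)
    {t : Fin k → ℝ} (ht : ∀ j, t j ∈ Ioo 1 (ξ j)) :
    ‖chebyshevCoeff f n‖ ≤ B * ∏ j, (t j ^ (n j).natAbs)⁻¹ := by
  have t_nonneg (j : Fin k) : 0 ≤ t j := zero_le_one.trans (ht j).1.le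
  have radii_mem (j : Fin k) : t j ^ (n j).sign ∈ Ioo (ξ j)⁻¹ (ξ j) := zpow_sign_mem_Ioo (ht j) _
  rw [chebyshevCoeff_eq_integral_torusPoint hξ hf n radii_mem]
  refine (norm_integral_le_of_norm_le_const (.of_forall fun x => ?_)).trans_eq
    (by rw [probReal_univ, mul_one])
  rw [norm_mul, mul_comm, norm_prod]
  simp only [norm_torusPoint_zpow_sign (t_nonneg _)]
  refine mul_le_mul_of_nonneg_right (hB _ (joukowski_mem_interior_polyellipse hξ
    (torusPoint_mem_polyannulus (fun j => inv_nonneg.2 (zero_le_one.trans (hξ j).le))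
      radii_mem x)) fun j hj => ?_)
    (Finset.prod_nonneg fun j _ => inv_nonneg.2 (pow_nonneg (t_nonneg j) _))
  simp only [torusPoint, hj, Int.sign_zero, zpow_zero, Complex.ofReal_one, one_mul]
  exact exists_eq_joukowski_toCircle (x j)

theorem norm_chebyshevCoeff_le_of_forall (hξ : ∀ j, 1 < ξ j)
    (hf : DifferentiableOn ℂ f (interior (polyellipse ξ))) {n : Fin k → ℤ} {B : ℝ}
    (hB : ∀ z ∈ interior (polyellipse ξ),
      (∀ j, n j = 0 → ∃ y ∈ Icc (-1 : ℝ) 1, z j = y) → ‖f z‖ ≤ B) :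
    ‖chebyshevCoeff f n‖ ≤ B * ∏ j, (ξ j ^ (n j).natAbs)⁻¹ := by
  have mem_closure : ξ ∈ closure (univ.pi fun j => Ioo 1 (ξ j)) := by
    rw [closure_pi_set]
    intro j _
    change ξ j ∈ closure (Ioo 1 (ξ j))
    rw [closure_Ioo (hξ j).ne]
    exact right_mem_Icc.2 (hξ j).le
  have continuousAt_bound :
      ContinuousAt (fun t : Fin k → ℝ => B * ∏ j, (t j ^ (n j).natAbs)⁻¹) ξ :=
    continuousAt_const.mul (tendsto_finsetProd _ fun j _ =>
      ((continuous_apply j).continuousAt.pow _).inv₀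
        (pow_ne_zero _ (zero_lt_one.trans (hξ j)).ne'))
  exact continuousWithinAt_const.closure_le mem_closure continuousAt_bound.continuousWithinAt
    fun t ht => norm_chebyshevCoeff_le_of_radii hξ hf hB fun j => ht j (mem_univ j)

theorem norm_chebyshevCoeff_le {d : ℕ} {ξ : Fin (d + 1) → ℝ} (hξ : ∀ j, 1 < ξ j)
    {f : (Fin (d + 1) → ℂ) → ℂ} (hf : DifferentiableOn ℂ f (interior (polyellipse ξ))) {M : ℝ}
    (hM : ∀ z ∈ interior (polyellipse ξ), ‖f z‖ ≤ M)
    (hM' : ∀ z ∈ interior (polyellipse ξ) ∩ polyellipseRealLast ξ, ‖f z‖ ≤ M / ξ (Fin.last d))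
    (n : Fin (d + 1) → ℤ) :
    ‖chebyshevCoeff f n‖ ≤ M * gamma ξ fun j => (n j).natAbs := by
  rw [gamma]
  by_cases last_eq_zero : n (Fin.last d) = 0
  · have norm_le := norm_chebyshevCoeff_le_of_forall hξ hf (n := n) fun z hz real_of_eq_zero =>
      hM' z ⟨hz, fun j => interior_subset hz _, real_of_eq_zero _ last_eq_zero⟩
    simpa [Fin.prod_univ_castSucc, last_eq_zero, div_eq_mul_inv, mul_assoc] using norm_le
  · have norm_le := norm_chebyshevCoeff_le_of_forall hξ hf (n := n) fun z hz _ => hM z hz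
    rw [Fin.prod_univ_castSucc] at norm_le
    rw [max_eq_right (Int.natAbs_pos.2 last_eq_zero)]
    simpa only [mul_comm] using norm_le

end ChebyshevExpansion

section ConnectionCoefficients

variable {k : ℕ}

theorem hasSum_mul_integral_mul {X ι : Type*} [MeasurableSpace X] {μ : Measure X} [Countable ι]
    {c : ι → ℂ} (hc : Summable c) {p : ι → X → ℝ} (hp : ∀ i, AEStronglyMeasurable (p i) μ)
    (hp_le : ∀ i, ∀ᵐ x ∂μ, |p i x| ≤ 1) {g : X → ℝ} (hg : Integrable g μ) {f : X → ℂ}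
    (hf : ∀ᵐ x ∂μ, HasSum (fun i => c i * p i x) (f x)) :
    HasSum (fun i => c i * ((∫ x, p i x * g x ∂μ : ℝ) : ℂ)) (∫ x, f x * g x ∂μ) := by
  have integral_term (i : ι) : ∫ x, c i * p i x * (g x : ℂ) ∂μ
      = c i * ((∫ x, p i x * g x ∂μ : ℝ) : ℂ) := by
    rw [← integral_complex_ofReal, ← integral_const_mul]
    simp only [Complex.ofReal_mul, mul_assoc]
  simp only [← integral_term]
  refine hasSum_integral_of_dominated_convergence (fun i x => ‖c i‖ * |g x|) (fun i => ?_)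
    (fun i => ?_) (.of_forall fun x => hc.norm.mul_right _) ?_ ?_
  · exact ((Complex.continuous_ofReal.comp_aestronglyMeasurable (hp i)).const_mul _).mul
      hg.ofReal.aestronglyMeasurable
  · filter_upwards [hp_le i] with x hx
    rw [norm_mul, norm_mul, Complex.norm_real, Complex.norm_real, Real.norm_eq_abs,
      Real.norm_eq_abs]
    exact mul_le_mul_of_nonneg_right (mul_le_of_le_one_right (norm_nonneg _) hx) (abs_nonneg _)
  · simp only [tsum_mul_right]
    exact hg.abs.const_mul _
  · filter_upwards [hf] with x hx
    exact hx.mul_right _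

theorem integrable_legendreTensor (ν : Fin k → ℕ) : Integrable (legendreTensor ν) (mu k) :=
  Integrable.fintype_prod fun j => integrable_mu1_of_continuous (legendre (ν j)).continuous

theorem integral_prod_eval_mul_legendreTensor (p : Fin k → ℝ[X]) (ν : Fin k → ℕ) :
    ∫ y, (∏ j, (p j).eval (y j)) * legendreTensor ν y ∂mu k
      = ∏ j, legendreFunctional (ν j) (p j) := by
  simp only [legendreTensor, ← Finset.prod_mul_distrib, legendreFunctional_apply]
  exact integral_fintype_prod_eq_prod fun j x => (p j).eval x * (legendre (ν j)).eval x

/-- The coefficient of the tensorized Legendre polynomial with index `ν` in the expansion of the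
product of the Chebyshev polynomials with degrees `|n j|`. -/
noncomputable def connectionCoeff (n : Fin k → ℤ) (ν : Fin k → ℕ) : ℝ :=
  ∏ j, legendreFunctional (ν j) (Chebyshev.T ℝ (n j))

theorem abs_connectionCoeff_le_one (n : Fin k → ℤ) (ν : Fin k → ℕ) :
    |connectionCoeff n ν| ≤ 1 := by
  rw [connectionCoeff, Finset.abs_prod]
  exact Finset.prod_le_one (fun _ _ => abs_nonneg _) fun j _ =>
    abs_legendreFunctional_le_one _ fun x hx => Chebyshev.abs_eval_T_real_le_one _ (abs_le.2 hx)

theorem connectionCoeff_eq_zero {n : Fin k → ℤ} {ν : Fin k → ℕ}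
    (h : ¬ν ≤ fun j => (n j).natAbs) : connectionCoeff n ν = 0 := by
  obtain ⟨j, hj⟩ := not_forall.1 h
  refine Finset.prod_eq_zero (Finset.mem_univ j) (legendreFunctional_eq_zero_of_natDegree_lt ?_)
  rw [Chebyshev.natDegree_T]
  exact not_le.1 hj

theorem polyTensor_T_eq_sum (n : Fin k → ℤ) (α : Fin k → ℕ) (y : Fin k → ℝ) :
    polyTensor (fun j => Chebyshev.T ℝ (n j)) α y
      = ∑ ν ∈ Finset.Iic fun j => (n j).natAbs,
        (connectionCoeff n ν : ℂ) * polyTensor (fun j => legendre (ν j)) α y := by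
  have factor_eq_sum (j : Fin k) : (derivative^[α j] (Chebyshev.T ℝ (n j))).eval (y j)
      = ∑ i ∈ Finset.Iic (n j).natAbs, legendreFunctional i (Chebyshev.T ℝ (n j)) *
        (derivative^[α j] (legendre i)).eval (y j) := by
    conv_lhs => rw [eq_sum_legendre (Chebyshev.natDegree_T ℝ (n j)).le]
    rw [iterate_derivative_sum, eval_finsetSum, ← Nat.range_succ_eq_Iic]
    simp only [iterate_derivative_smul, eval_smul, smul_eq_mul]
  simp only [polyTensor, factor_eq_sum, Finset.prod_univ_sum, connectionCoeff,
    Finset.prod_mul_distrib, Complex.ofReal_sum, Complex.ofReal_mul]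
  rfl

theorem HasChebyshevExpansion.hasSum_legendreCoeff {f : (Fin k → ℂ) → ℂ} {c : (Fin k → ℤ) → ℂ}
    (hf : HasChebyshevExpansion f c) (ν : Fin k → ℕ) :
    HasSum (fun n => c n * (connectionCoeff n ν : ℂ)) (legendreCoeff f ν) := by
  simp only [connectionCoeff, ← integral_prod_eval_mul_legendreTensor]
  refine hasSum_mul_integral_mul hf.summable (fun n => ?_) (fun n => ?_)
    (integrable_legendreTensor ν) ((ae_mem_Icc_mu k).mono hf.hasSum)
  · exact (continuous_finsetProd _ fun j _ => (Chebyshev.T ℝ (n j)).continuous.comp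
      (continuous_apply j)).aestronglyMeasurable
  · filter_upwards [ae_mem_Icc_mu k] with y hy
    rw [Finset.abs_prod]
    exact Finset.prod_le_one (fun _ _ => abs_nonneg _) fun j _ =>
      Chebyshev.abs_eval_T_real_le_one _ (abs_le.2 (hy j))

end ConnectionCoefficients

section ChebyshevRemainder

variable {k : ℕ} {s : Finset (Fin k → ℕ)}

/-- The part outside `s` of the Legendre expansion of the product of the Chebyshev polynomials
with degrees `|n j|`, together with its mixed derivatives. It is what the `n`-th term of the
Chebyshev series contributes to the truncation error. -/
noncomputable def chebyshevRemainder (s : Finset (Fin k → ℕ)) (n : Fin k → ℤ) (α : Fin k → ℕ)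
    (y : Fin k → ℝ) : ℂ :=
  ∑ ν ∈ (Finset.Iic fun j => (n j).natAbs) \ s,
    (connectionCoeff n ν : ℂ) * polyTensor (fun j => legendre (ν j)) α y

theorem isJet_chebyshevRemainder (s : Finset (Fin k → ℕ)) (n : Fin k → ℤ)
    (U : Set (Fin k → ℝ)) : IsJet (chebyshevRemainder s n) U :=
  IsJet.sum fun _ _ => (isJet_polyTensor _ U).const_mul _

theorem chebyshevRemainder_eq_sub (s : Finset (Fin k → ℕ)) (n : Fin k → ℤ) (α : Fin k → ℕ)
    (y : Fin k → ℝ) :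
    chebyshevRemainder s n α y = polyTensor (fun j => Chebyshev.T ℝ (n j)) α y -
      ∑ ν ∈ s, (connectionCoeff n ν : ℂ) * polyTensor (fun j => legendre (ν j)) α y := by
  rw [polyTensor_T_eq_sum, eq_sub_iff_add_eq', chebyshevRemainder,
    ← Finset.sum_inter_add_sum_sdiff (Finset.Iic fun j => (n j).natAbs) s, add_left_inj]
  refine (Finset.sum_subset Finset.inter_subset_right fun ν mem_s notMem_inter => ?_).symm
  have not_le : ¬ν ≤ fun j => (n j).natAbs := fun le =>
    notMem_inter (Finset.mem_inter.2 ⟨Finset.mem_Iic.2 le, mem_s⟩)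
  rw [connectionCoeff_eq_zero not_le, Complex.ofReal_zero, zero_mul]

theorem chebyshevRemainder_eq_zero (hs : IsLowerSet (s : Set (Fin k → ℕ))) {n : Fin k → ℤ}
    (hn : (fun j => (n j).natAbs) ∈ s) : chebyshevRemainder s n = 0 := by
  have subset : (Finset.Iic fun j => (n j).natAbs) ⊆ s := fun _ hν => hs (Finset.mem_Iic.1 hν) hn
  ext α y
  rw [chebyshevRemainder, Finset.sdiff_eq_empty_iff_subset.2 subset, Finset.sum_empty,
    Pi.zero_apply, Pi.zero_apply]

theorem norm_chebyshevRemainder_le_prod_sum (s : Finset (Fin k → ℕ)) (n : Fin k → ℤ)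
    (α : Fin k → ℕ) (y : Fin k → ℝ) :
    ‖chebyshevRemainder s n α y‖
      ≤ ∏ j, ∑ i ∈ Finset.Iic (n j).natAbs, |(derivative^[α j] (legendre i)).eval (y j)| := by
  have norm_term_le (ν : Fin k → ℕ) :
      ‖(connectionCoeff n ν : ℂ) * polyTensor (fun j => legendre (ν j)) α y‖
        ≤ ∏ j, |(derivative^[α j] (legendre (ν j))).eval (y j)| := by
    rw [norm_mul, polyTensor, Complex.norm_real, Complex.norm_real, Real.norm_eq_abs,
      Real.norm_eq_abs, Finset.abs_prod]
    exact mul_le_of_le_one_left (Finset.prod_nonneg fun _ _ => abs_nonneg _)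
      (abs_connectionCoeff_le_one n ν)
  calc ‖chebyshevRemainder s n α y‖
      ≤ ∑ ν ∈ (Finset.Iic fun j => (n j).natAbs) \ s,
          ∏ j, |(derivative^[α j] (legendre (ν j))).eval (y j)| :=
        norm_sum_le_of_le _ fun ν _ => norm_term_le ν
    _ ≤ ∑ ν ∈ Finset.Iic fun j => (n j).natAbs,
          ∏ j, |(derivative^[α j] (legendre (ν j))).eval (y j)| :=
        Finset.sum_le_sum_of_subset_of_nonneg Finset.sdiff_subset fun _ _ _ =>
          Finset.prod_nonneg fun _ _ => abs_nonneg _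
    _ = ∏ j, ∑ i ∈ Finset.Iic (n j).natAbs, |(derivative^[α j] (legendre i)).eval (y j)| := by
        rw [Finset.prod_univ_sum]
        rfl

theorem sum_abs_iterate_derivative_legendre_le {k r : ℕ} (hkr : k ≤ r) (N : ℕ) {x : ℝ}
    (hx : x ∈ Icc (-1 : ℝ) 1) :
    ∑ i ∈ Finset.Iic N, |(derivative^[k] (legendre i)).eval x|
      ≤ 2 * (2 * ((N : ℝ) + 1) ^ 2) ^ (r + 2) := by
  have one_le : 1 ≤ 2 * ((N : ℝ) + 1) ^ 2 := by nlinarith [Nat.cast_nonneg (α := ℝ) N]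
  have term_le (i : ℕ) (hi : i ∈ Finset.Iic N) :
      |(derivative^[k] (legendre i)).eval x| ≤ 2 * (2 * ((N : ℝ) + 1) ^ 2) ^ (r + 1) := by
    have i_le_N : (i : ℝ) ≤ N := Nat.cast_le.2 (Finset.mem_Iic.1 hi)
    calc |(derivative^[k] (legendre i)).eval x|
        ≤ 2 * (2 * ((i : ℝ) + 1) ^ 2) ^ (k + 1) := abs_iterate_derivative_legendre_le i k hx
      _ ≤ 2 * (2 * ((N : ℝ) + 1) ^ 2) ^ (k + 1) := by gcongr
      _ ≤ 2 * (2 * ((N : ℝ) + 1) ^ 2) ^ (r + 1) := by gcongr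
  calc ∑ i ∈ Finset.Iic N, |(derivative^[k] (legendre i)).eval x|
      ≤ (N + 1) * (2 * (2 * ((N : ℝ) + 1) ^ 2) ^ (r + 1)) := by
        simpa using Finset.sum_le_card_nsmul _ _ _ term_le
    _ ≤ 2 * ((N : ℝ) + 1) ^ 2 * (2 * (2 * ((N : ℝ) + 1) ^ 2) ^ (r + 1)) := by
        gcongr
        nlinarith [Nat.cast_nonneg (α := ℝ) N]
    _ = 2 * (2 * ((N : ℝ) + 1) ^ 2) ^ (r + 2) := by ring

theorem norm_chebyshevRemainder_le (s : Finset (Fin k → ℕ)) (n : Fin k → ℤ) {α : Fin k → ℕ}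
    {r : ℕ} (hα : ∀ j, α j ≤ r) {y : Fin k → ℝ} (hy : ∀ j, y j ∈ Icc (-1 : ℝ) 1) :
    ‖chebyshevRemainder s n α y‖ ≤ ∏ j, 2 * (2 * (((n j).natAbs : ℝ) + 1) ^ 2) ^ (r + 2) :=
  (norm_chebyshevRemainder_le_prod_sum s n α y).trans <|
    Finset.prod_le_prod (fun _ _ => Finset.sum_nonneg fun _ _ => abs_nonneg _) fun j _ =>
      sum_abs_iterate_derivative_legendre_le (hα j) _ (hy j)

end ChebyshevRemainder

section Gamma

variable {d : ℕ} {ξ : Fin (d + 1) → ℝ}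

theorem gamma_pos (hξ : ∀ j, 0 < ξ j) (ν : Fin (d + 1) → ℕ) : 0 < gamma ξ ν :=
  mul_pos (inv_pos.2 (pow_pos (hξ _) _)) (Finset.prod_pos fun _ _ => inv_pos.2 (pow_pos (hξ _) _))

theorem antitone_gamma (hξ : ∀ j, 1 ≤ ξ j) : Antitone (gamma ξ) := by
  intro ν ν' hνν'
  have ξ_pos (j : Fin (d + 1)) : 0 < ξ j := zero_lt_one.trans_le (hξ j)
  have inv_pow_nonneg (j : Fin (d + 1)) (i : ℕ) : 0 ≤ (ξ j ^ i)⁻¹ :=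
    inv_nonneg.2 (pow_nonneg (ξ_pos j).le i)
  have inv_pow_anti (j : Fin (d + 1)) {i i' : ℕ} (hi : i ≤ i') : (ξ j ^ i')⁻¹ ≤ (ξ j ^ i)⁻¹ :=
    inv_anti₀ (pow_pos (ξ_pos j) _) (pow_le_pow_right₀ (hξ j) hi)
  exact mul_le_mul (inv_pow_anti _ (max_le_max le_rfl (hνν' _)))
    (Finset.prod_le_prod (fun _ _ => inv_pow_nonneg _ _) fun j _ => inv_pow_anti _ (hνν' _))
    (Finset.prod_nonneg fun _ _ => inv_pow_nonneg _ _) (inv_pow_nonneg _ _)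

theorem isLowerSet_indexSet (hξ : ∀ j, 1 ≤ ξ j) (ε : ℝ) : IsLowerSet (indexSet ξ ε) :=
  fun _ _ hle (hν : ε ≤ _) => hν.trans (antitone_gamma hξ hle)

theorem gamma_le_prod_pow {a : ℝ} (ha : 1 ≤ a) (haξ : ∀ j, a ≤ ξ j) (ν : Fin (d + 1) → ℕ) :
    gamma ξ ν ≤ ∏ j, a⁻¹ ^ ν j := by
  have a_pos : 0 < a := zero_lt_one.trans_le ha
  refine (gamma_le_prod (fun j => ha.trans (haξ j)) ν).trans (Finset.prod_le_prod
    (fun j _ => inv_nonneg.2 (pow_nonneg (a_pos.le.trans (haξ j)) _)) fun j _ => ?_)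
  rw [inv_pow]
  exact inv_anti₀ (pow_pos a_pos _) (pow_le_pow_left₀ a_pos.le (haξ j) _)

theorem gamma_le_rpow_mul_prod {a : ℝ} (ha : 1 ≤ a) (haξ : ∀ j, a ≤ ξ j) {τ : ℝ}
    (hτ : τ ∈ Icc (0 : ℝ) 1) {ε : ℝ} {ν : Fin (d + 1) → ℕ} (hν : gamma ξ ν ≤ ε) :
    gamma ξ ν ≤ ε ^ τ * ∏ j, (a⁻¹ ^ (1 - τ)) ^ ν j := by
  have a_inv_nonneg : 0 ≤ a⁻¹ := inv_nonneg.2 (zero_le_one.trans ha)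
  have gamma_ν_pos := gamma_pos (fun j => zero_lt_one.trans_le (ha.trans (haξ j))) ν
  calc gamma ξ ν = gamma ξ ν ^ τ * gamma ξ ν ^ (1 - τ) := by
        rw [← Real.rpow_add gamma_ν_pos, add_sub_cancel, Real.rpow_one]
    _ ≤ ε ^ τ * (∏ j, a⁻¹ ^ ν j) ^ (1 - τ) := by
        gcongr
        exacts [Real.rpow_nonneg (gamma_ν_pos.le.trans hν) _, hτ.1, sub_nonneg.2 hτ.2,
          gamma_le_prod_pow ha haξ ν]
    _ = ε ^ τ * ∏ j, (a⁻¹ ^ (1 - τ)) ^ ν j := by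
        rw [← Real.finsetProd_rpow _ _ fun j _ => pow_nonneg a_inv_nonneg _]
        simp only [← Real.rpow_natCast, ← Real.rpow_mul a_inv_nonneg, mul_comm]

end Gamma

section Summability

theorem summable_prod_apply {κ ι : Type*} [Fintype κ] {g : κ → ι → ℝ} (hg0 : ∀ j i, 0 ≤ g j i)
    (hg : ∀ j, Summable (g j)) : Summable fun n : κ → ι => ∏ j, g j (n j) := by
  classical
  refine summable_of_sum_le (c := ∏ j, ∑' i, g j i)
    (fun n => Finset.prod_nonneg fun j _ => hg0 j _) fun s => ?_
  have subset_box : s ⊆ Fintype.piFinset fun j => s.image fun n => n j := fun n hn =>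
    Fintype.mem_piFinset.2 fun j => Finset.mem_image_of_mem _ hn
  calc ∑ n ∈ s, ∏ j, g j (n j)
      ≤ ∑ n ∈ Fintype.piFinset fun j => s.image fun n => n j, ∏ j, g j (n j) :=
        Finset.sum_le_sum_of_subset_of_nonneg subset_box fun n _ _ =>
          Finset.prod_nonneg fun j _ => hg0 j _
    _ = ∏ j, ∑ i ∈ s.image fun n => n j, g j i := (Finset.prod_univ_sum ..).symm
    _ ≤ ∏ j, ∑' i, g j i :=
        Finset.prod_le_prod (fun j _ => Finset.sum_nonneg fun i _ => hg0 j i)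
          fun j _ => (hg j).sum_le_tsum _ fun i _ => hg0 j i

theorem summable_prod_natAbs {κ : Type*} [Fintype κ] {g : κ → ℕ → ℝ} (hg0 : ∀ j i, 0 ≤ g j i)
    (hg : ∀ j, Summable (g j)) : Summable fun n : κ → ℤ => ∏ j, g j (n j).natAbs :=
  summable_prod_apply (g := fun j (i : ℤ) => g j i.natAbs) (fun j i => hg0 j i.natAbs) fun j =>
    .of_nat_of_neg (by simpa using hg j) (by simpa using hg j)

theorem summable_succ_pow_mul_geometric (p : ℕ) {q : ℝ} (hq : |q| < 1) :
    Summable fun i : ℕ => ((i : ℝ) + 1) ^ p * q ^ i := by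
  simp only [add_pow, one_pow, mul_one, Finset.sum_mul]
  refine summable_sum fun m _ =>
    ((summable_pow_mul_geometric_of_norm_lt_one m hq).mul_left (p.choose m : ℝ)).congr fun i => ?_
  ring

end Summability

section RemainderSeries

variable {k : ℕ} {f : (Fin k → ℂ) → ℂ} {c : (Fin k → ℤ) → ℂ} {s : Finset (Fin k → ℕ)} {B q : ℝ}

/-- A weight that decays geometrically with ratio `q` up to the polynomial factors by which the
derivatives of order at most `r` of the `n`-th Chebyshev remainder grow. -/
noncomputable def errorWeight (q : ℝ) (r : ℕ) (n : Fin k → ℤ) : ℝ :=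
  ∏ j, 2 * (2 * (((n j).natAbs : ℝ) + 1) ^ 2) ^ (r + 2) * q ^ (n j).natAbs

theorem errorWeight_nonneg (hq : 0 ≤ q) (r : ℕ) (n : Fin k → ℤ) : 0 ≤ errorWeight q r n :=
  Finset.prod_nonneg fun _ _ => by positivity

theorem errorWeight_pos (hq : 0 < q) (r : ℕ) (n : Fin k → ℤ) : 0 < errorWeight q r n :=
  Finset.prod_pos fun _ _ => by positivity

theorem summable_errorWeight (hq : q ∈ Ico (0 : ℝ) 1) (r : ℕ) :
    Summable (errorWeight q r : (Fin k → ℤ) → ℝ) := by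
  refine summable_prod_natAbs
    (g := fun _ i => 2 * (2 * ((i : ℝ) + 1) ^ 2) ^ (r + 2) * q ^ i)
    (fun _ i => mul_nonneg (by positivity) (pow_nonneg hq.1 i)) fun _ => ?_
  refine ((summable_succ_pow_mul_geometric (2 * (r + 2))
    ((abs_of_nonneg hq.1).trans_lt hq.2)).mul_left (2 * 2 ^ (r + 2))).congr fun i => ?_
  rw [mul_pow, ← pow_mul]
  ring

theorem norm_mul_chebyshevRemainder_le (hs : IsLowerSet (s : Set (Fin k → ℕ))) (hB : 0 ≤ B)
    (hq : 0 ≤ q) {n : Fin k → ℤ}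
    (hc : (fun j => (n j).natAbs) ∉ s → ‖c n‖ ≤ B * ∏ j, q ^ (n j).natAbs) {α : Fin k → ℕ} {r : ℕ}
    (hα : ∀ j, α j ≤ r) {y : Fin k → ℝ} (hy : ∀ j, y j ∈ Icc (-1 : ℝ) 1) :
    ‖c n * chebyshevRemainder s n α y‖ ≤ B * errorWeight q r n := by
  by_cases hn : (fun j => (n j).natAbs) ∈ s
  · rw [chebyshevRemainder_eq_zero hs hn, Pi.zero_apply, Pi.zero_apply, mul_zero, norm_zero]
    exact mul_nonneg hB (errorWeight_nonneg hq r n)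
  calc ‖c n * chebyshevRemainder s n α y‖
      ≤ (B * ∏ j, q ^ (n j).natAbs) * ∏ j, 2 * (2 * (((n j).natAbs : ℝ) + 1) ^ 2) ^ (r + 2) :=
        norm_mul_le_of_le (hc hn) (norm_chebyshevRemainder_le s n hα hy)
    _ = B * errorWeight q r n := by
        rw [errorWeight, Finset.prod_mul_distrib (g := fun j => q ^ (n j).natAbs)]
        ring

theorem mem_Icc_of_mem_openCube {y : Fin k → ℝ} (hy : y ∈ openCube k) (j : Fin k) :
    y j ∈ Icc (-1 : ℝ) 1 :=
  Ioo_subset_Icc_self (hy j (mem_univ j))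

theorem isJet_tsum_mul_chebyshevRemainder (hs : IsLowerSet (s : Set (Fin k → ℕ))) (hB : 0 ≤ B)
    (hq : q ∈ Ico (0 : ℝ) 1)
    (hc : ∀ n, (fun j => (n j).natAbs) ∉ s → ‖c n‖ ≤ B * ∏ j, q ^ (n j).natAbs) :
    IsJet (fun α y => ∑' n, c n * chebyshevRemainder s n α y) (openCube k) :=
  IsJet.tsum (F := fun n α y => c n * chebyshevRemainder s n α y)
    (fun n => (isJet_chebyshevRemainder s n _).const_mul (c n)) (isOpen_openCube k)
    (isPreconnected_openCube k) (fun α => (summable_errorWeight hq (∑ j, α j)).mul_left B)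
    fun n _ _ hy => norm_mul_chebyshevRemainder_le hs hB hq.1 (hc n)
      (fun j => Finset.single_le_sum (fun _ _ => Nat.zero_le _) (Finset.mem_univ j))
      (mem_Icc_of_mem_openCube hy)

theorem HasChebyshevExpansion.eqOn_truncationError (hf : HasChebyshevExpansion f c)
    (s : Finset (Fin k → ℕ)) :
    EqOn (truncationError f s) (fun y => ∑' n, c n * chebyshevRemainder s n 0 y)
      (openCube k) := by
  intro y hy
  have hasSum_truncation : HasSum
      (fun n => ∑ ν ∈ s, c n * (connectionCoeff n ν : ℂ) * (legendreTensor ν y : ℂ))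
      (∑ ν ∈ s, legendreCoeff f ν * (legendreTensor ν y : ℂ)) :=
    hasSum_sum fun ν _ => (hf.hasSum_legendreCoeff ν).mul_right _
  have hasSum_error := (hf.hasSum y (mem_Icc_of_mem_openCube hy)).sub hasSum_truncation
  rw [truncationError, finsum_mem_coe_finset, ← hasSum_error.tsum_eq]
  refine tsum_congr fun n => ?_
  rw [chebyshevRemainder_eq_sub, mul_sub, Finset.mul_sum]
  simp only [polyTensor, legendreTensor, Pi.zero_apply, Function.iterate_zero, id, mul_assoc]

theorem HasChebyshevExpansion.contDiffOn_truncationError (hf : HasChebyshevExpansion f c)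
    (hs : IsLowerSet (s : Set (Fin k → ℕ))) (hB : 0 ≤ B) (hq : q ∈ Ico (0 : ℝ) 1)
    (hc : ∀ n, (fun j => (n j).natAbs) ∉ s → ‖c n‖ ≤ B * ∏ j, q ^ (n j).natAbs) (m : ℕ) :
    ContDiffOn ℝ m (truncationError f s) (openCube k) :=
  ((isJet_tsum_mul_chebyshevRemainder hs hB hq hc).contDiffOn (isOpen_openCube k) m 0).congr
    (hf.eqOn_truncationError s)

theorem HasChebyshevExpansion.sobolevNorm_truncationError_le (hf : HasChebyshevExpansion f c)
    (hs : IsLowerSet (s : Set (Fin k → ℕ))) (hB : 0 ≤ B) (hq : q ∈ Ico (0 : ℝ) 1)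
    (hc : ∀ n, (fun j => (n j).natAbs) ∉ s → ‖c n‖ ≤ B * ∏ j, q ^ (n j).natAbs) (m : ℕ) :
    sobolevNorm m (truncationError f s)
      ≤ ENNReal.ofReal (B * ∑' n : Fin k → ℤ, errorWeight q m n) := by
  refine (isJet_tsum_mul_chebyshevRemainder hs hB hq hc).sobolevNorm_le
    (hf.eqOn_truncationError s) fun α hα y hy => ?_
  have α_le (j : Fin k) : α j ≤ m :=
    (Finset.single_le_sum (fun _ _ => Nat.zero_le _) (Finset.mem_univ j)).trans hα
  exact tsum_of_norm_bounded ((summable_errorWeight hq m).hasSum.mul_left B) fun n =>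
    norm_mul_chebyshevRemainder_le hs hB hq.1 (hc n) α_le (mem_Icc_of_mem_openCube hy)

end RemainderSeries

section GammaDecay

variable {d : ℕ} {ξ : Fin (d + 1) → ℝ} {c : (Fin (d + 1) → ℤ) → ℂ} {M : ℝ}

theorem summable_of_norm_le_mul_gamma (hξ : ∀ j, 1 < ξ j) (hM : 0 ≤ M)
    (hc : ∀ n, ‖c n‖ ≤ M * gamma ξ fun j => (n j).natAbs) : Summable c := by
  have ξ_inv_nonneg (j : Fin (d + 1)) : 0 ≤ (ξ j)⁻¹ := inv_nonneg.2 (zero_le_one.trans (hξ j).le)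
  have summable_prod : Summable fun n : Fin (d + 1) → ℤ => ∏ j, (ξ j)⁻¹ ^ (n j).natAbs :=
    summable_prod_natAbs (g := fun j i => (ξ j)⁻¹ ^ i) (fun j i => pow_nonneg (ξ_inv_nonneg j) i)
      fun j => summable_geometric_of_lt_one (ξ_inv_nonneg j) (inv_lt_one_of_one_lt₀ (hξ j))
  refine .of_norm_bounded (summable_prod.mul_left M) fun n =>
    (hc n).trans (mul_le_mul_of_nonneg_left ?_ hM)
  simpa only [inv_pow] using gamma_le_prod (fun j => (hξ j).le) fun j => (n j).natAbs

theorem norm_le_of_norm_le_mul_gamma {a : ℝ} (ha : 1 ≤ a) (haξ : ∀ j, a ≤ ξ j) {τ : ℝ}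
    (hτ : τ ∈ Icc (0 : ℝ) 1) {ε : ℝ} (hM : 0 ≤ M) {n : Fin (d + 1) → ℤ}
    (hc : ‖c n‖ ≤ M * gamma ξ fun j => (n j).natAbs)
    (hn : (fun j => (n j).natAbs) ∉ indexSet ξ ε) :
    ‖c n‖ ≤ M * ε ^ τ * ∏ j, (a⁻¹ ^ (1 - τ)) ^ (n j).natAbs := by
  rw [mul_assoc]
  exact hc.trans (mul_le_mul_of_nonneg_left
    (gamma_le_rpow_mul_prod ha haξ hτ (lt_of_not_ge hn).le) hM)

theorem nonneg_of_norm_le_mul_gamma (hξ : ∀ j, 0 < ξ j) {n : Fin (d + 1) → ℤ}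
    (hc : ‖c n‖ ≤ M * gamma ξ fun j => (n j).natAbs) : 0 ≤ M :=
  nonneg_of_mul_nonneg_left ((norm_nonneg _).trans hc) (gamma_pos hξ _)

theorem rpow_one_sub_mem_Ioo {a τ : ℝ} (ha : 1 < a) (hτ : τ < 1) :
    a⁻¹ ^ (1 - τ) ∈ Ioo (0 : ℝ) 1 :=
  ⟨Real.rpow_pos_of_pos (inv_pos.2 (zero_lt_one.trans ha)) _,
    Real.rpow_lt_one (inv_nonneg.2 (zero_le_one.trans ha.le)) (inv_lt_one_of_one_lt₀ ha)
      (sub_pos.2 hτ)⟩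

end GammaDecay

section Extrema

theorem lt_ciInf_of_finite {ι α : Type*} [Finite ι] [Nonempty ι]
    [ConditionallyCompleteLinearOrder α] {g : ι → α} {a : α} (h : ∀ i, a < g i) :
    a < ⨅ i, g i := by
  obtain ⟨i, hi⟩ := exists_eq_ciInf_of_finite (f := g)
  exact hi ▸ h i

variable {k : ℕ} {f : (Fin k → ℂ) → ℂ} {O : Set (Fin k → ℂ)} {r ρ : ℝ}

theorem norm_le_supNormOn (hr : ∀ z ∈ O, ‖f z‖ ≤ r) {z : Fin k → ℂ} (hz : z ∈ O) :
    ‖f z‖ ≤ supNormOn f O :=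
  le_ciSup (f := fun z : O => ‖f z‖) ⟨r, forall_mem_range.2 fun z => hr z z.2⟩ ⟨z, hz⟩

theorem norm_le_min_mul_supNormOn (hρ : 1 ≤ ρ) (hr : ∀ z ∈ O, ‖f z‖ ≤ r) {z : Fin k → ℂ}
    (hz : z ∈ O) : ‖f z‖ ≤ min r (ρ * supNormOn f O) := by
  have norm_le := norm_le_supNormOn hr hz
  exact le_min (hr z hz)
    (norm_le.trans (le_mul_of_one_le_left ((norm_nonneg _).trans norm_le) hρ))

theorem norm_le_min_mul_supNormOn_div (hρ : 0 < ρ) (hr : ∀ z ∈ O, ‖f z‖ ≤ r) {z : Fin k → ℂ}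
    (hz : z ∈ O) (hrz : ‖f z‖ ≤ r / ρ) : ‖f z‖ ≤ min r (ρ * supNormOn f O) / ρ := by
  rw [← min_div_div_right hρ.le, mul_div_cancel_left₀ _ hρ.ne']
  exact le_min hrz (norm_le_supNormOn hr hz)

end Extrema

end LegendreApprox

open LegendreApprox in
theorem mainTheorem9_general (d m : ℕ) {τ : ℝ} (hτ : τ ∈ Ico (0 : ℝ) 1) {a : ℝ} (ha : 1 < a) :
    ∃ C : ℝ, 0 < C ∧ ∀ ξ : Fin (d + 1) → ℝ, (∀ j, a ≤ ξ j) →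
      ∀ f : (Fin (d + 1) → ℂ) → ℂ, DifferentiableOn ℂ f (interior (polyellipse ξ)) →
      ∀ M : ℝ, (∀ z ∈ interior (polyellipse ξ), ‖f z‖ ≤ M) →
      (∀ z ∈ interior (polyellipse ξ) ∩ polyellipseRealLast ξ, ‖f z‖ ≤ M / ξ (Fin.last d)) →
      ∀ ε : ℝ, 0 < ε → ε ≤ 1 →
        (indexSet ξ ε).Finite ∧
        ContDiffOn ℝ m (truncationError f (indexSet ξ ε)) (openCube (d + 1)) ∧
        sobolevNorm m (truncationError f (indexSet ξ ε)) ≤ ENNReal.ofReal (C * ε ^ τ * M) ∧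
        C * ε ^ τ * M
          ≤ C * Real.exp (-τ * beta ξ *
              ((indexSet ξ ε).ncard : ℝ) ^ (1 / ((d + 1 : ℕ) : ℝ))) * M * ∏ j, ξ j := by
  obtain ⟨q_pos, q_lt_one⟩ := rpow_one_sub_mem_Ioo ha hτ.2
  have q_mem : a⁻¹ ^ (1 - τ) ∈ Ico (0 : ℝ) 1 := ⟨q_pos.le, q_lt_one⟩
  have C_pos : 0 < ∑' n : Fin (d + 1) → ℤ, errorWeight (a⁻¹ ^ (1 - τ)) m n :=
    (summable_errorWeight q_mem m).tsum_pos (fun n => errorWeight_nonneg q_pos.le m n) 0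
      (errorWeight_pos q_pos m 0)
  refine ⟨_, C_pos, fun ξ haξ f hf M hM hM' ε hε hε1 => ?_⟩
  have hξ (j : Fin (d + 1)) : 1 < ξ j := ha.trans_le (haξ j)
  have norm_le := norm_chebyshevCoeff_le hξ hf hM hM'
  have M_nonneg := nonneg_of_norm_le_mul_gamma (fun j => zero_lt_one.trans (hξ j)) (norm_le 0)
  have B_nonneg : 0 ≤ M * ε ^ τ := mul_nonneg M_nonneg (Real.rpow_nonneg hε.le τ)
  have expansion := hasChebyshevExpansion_chebyshevCoeff
    (continuous_comp_joukowski_toCircle hξ hf) (summable_of_norm_le_mul_gamma hξ M_nonneg norm_le)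
  have Λ_finite := finite_indexSet hξ hε
  have Λ_lower := isLowerSet_indexSet (fun j => (hξ j).le) ε
  have norm_le_of_notMem (n : Fin (d + 1) → ℤ) (hn : (fun j => (n j).natAbs) ∉ indexSet ξ ε) :=
    norm_le_of_norm_le_mul_gamma ha.le haξ (Ico_subset_Icc_self hτ) M_nonneg (norm_le n) hn
  have rpow_le := rpow_le_exp_mul_prod hξ hε hε1 (Ico_subset_Icc_self hτ)
  lift indexSet ξ ε to Finset (Fin (d + 1) → ℕ) using Λ_finite with Λ
  refine ⟨Λ.finite_toSet,
    expansion.contDiffOn_truncationError Λ_lower B_nonneg q_mem norm_le_of_notMem m,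
    ?_, ?_⟩
  · convert expansion.sobolevNorm_truncationError_le Λ_lower B_nonneg q_mem
      norm_le_of_notMem m using 2
    ring
  · linear_combination
      mul_le_mul_of_nonneg_left rpow_le (mul_nonneg C_pos.le M_nonneg)

theorem mainTheorem9
    (d m : ℕ) (τ : ℝ) (hτ : τ ∈ Set.Ioo (0 : ℝ) 1) (ξmin : ℝ) :
    ∃ C : ℝ, 0 < C ∧
      ∀ ξ : Fin (d + 1) → ℝ, (∀ j, 1 < ξ j) → (⨅ j, ξ j) = ξmin →
      ∀ r : ℝ, 0 < r →
      ∀ f : (Fin (d + 1) → ℂ) → ℂ,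
        LegendreApprox.HolomorphicC1On f (LegendreApprox.polyellipse ξ) →
        (∀ z ∈ LegendreApprox.polyellipse ξ, f z ∈ Metric.ball (0 : ℂ) r) →
        (∀ z ∈ LegendreApprox.polyellipseRealLast ξ,
          f z ∈ Metric.ball (0 : ℂ) (r / ξ (Fin.last d))) →
      ∀ ε : ℝ, 0 < ε → ε < (ξ (Fin.last d))⁻¹ →
        (LegendreApprox.indexSet ξ ε).Finite ∧
        ContDiffOn ℝ (m : ℕ∞)
          (LegendreApprox.truncationError f (LegendreApprox.indexSet ξ ε))
          (LegendreApprox.openCube (d + 1)) ∧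
        LegendreApprox.sobolevNorm m
            (LegendreApprox.truncationError f (LegendreApprox.indexSet ξ ε))
          ≤ ENNReal.ofReal (C * ε ^ τ *
              min r (ξ (Fin.last d) *
                LegendreApprox.supNormOn f (LegendreApprox.polyellipse ξ))) ∧
        C * ε ^ τ *
            min r (ξ (Fin.last d) *
              LegendreApprox.supNormOn f (LegendreApprox.polyellipse ξ))
          ≤ C * Real.exp (-τ * LegendreApprox.beta ξ *
                ((LegendreApprox.indexSet ξ ε).ncard : ℝ) ^ (1 / ((d + 1 : ℕ) : ℝ))) *
              min r (ξ (Fin.last d) *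
                LegendreApprox.supNormOn f (LegendreApprox.polyellipse ξ)) *
              ∏ j, ξ j := by
  by_cases one_lt_ξmin : 1 < ξmin
  swap
  · exact ⟨1, one_pos, fun ξ hξ hmin =>
      absurd (hmin ▸ LegendreApprox.lt_ciInf_of_finite hξ) one_lt_ξmin⟩
  obtain ⟨C, C_pos, hC⟩ := mainTheorem9_general d m (Ioo_subset_Ico_self hτ) one_lt_ξmin
  refine ⟨C, C_pos, fun ξ hξ hmin r _ f hf hfr hfr' ε hε hεξ => ?_⟩
  have norm_le (z) (hz : z ∈ LegendreApprox.polyellipse ξ) : ‖f z‖ ≤ r :=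
    (mem_ball_zero_iff.1 (hfr z hz)).le
  have norm_le_div (z) (hz : z ∈ LegendreApprox.polyellipseRealLast ξ) :
      ‖f z‖ ≤ r / ξ (Fin.last d) := (mem_ball_zero_iff.1 (hfr' z hz)).le
  exact hC ξ (fun j => hmin ▸ ciInf_le (finite_range ξ).bddBelow j) f hf.2 _
    (fun z hz => LegendreApprox.norm_le_min_mul_supNormOn (hξ _).le norm_le (interior_subset hz))
    (fun z hz => LegendreApprox.norm_le_min_mul_supNormOn_div (zero_lt_one.trans (hξ _)) norm_le
      (interior_subset hz.1) (norm_le_div z hz.2))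
    ε hε (hεξ.le.trans (inv_le_one_of_one_le₀ (hξ _).le))
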